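/- Notation. $\|\cdot\|$ is the Euclidean norm, $B(x,r)$ is the open Euclidean ball in $\mathbb R^d$ of centre $x$ and radius $r>0$, and $3B=B(x,3r)$ for $B=B(x,r)$. The space $\bigwedge^r(\mathbb R^{n+1})$ carries the Euclidean structure in which the vectors $e_{i_1}\wedge\dots\wedge e_{i_r}$ ($i_1<\dots<i_r$) are orthonormal. For $\varepsilon>0$, $K_\varepsilon$ is the set of lattices $\Lambda=g\mathbb Z^{n+1}$, $g\in \mathrm{SL}_{n+1}(\mathbb R)$, such that $\|v\|\ge\varepsilon$ for all nonzero $v\in\Lambda$. A collection $v_1,\dots,v_r\in\mathbb Z^{n+1}$ is primitive if it is linearly independent and $\mathrm{Span}_{\mathbb Z}(v_1,\dots,v_r)=\mathbb Z^{n+1}\cap \mathrm{Span}_{\mathbb R}(v_1,\dots,v_r)$. Let $U\subset\mathbb R^d$ be open. A measure $\mu$ on $\mathbb R^d$ is $D$-Federer on $U$ if $\mu(B(x,3r))<D\,\mu(B(x,r))$ for all $x\in\operatorname{supp}\mu\cap U$ and all $r>0$ with $B(x,3r)\subset U$. It is absolutely decaying on $U$ if there are $C,\alpha>0$ such that for every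 $x\in\operatorname{supp}\mu$ and $r>0$ with $B(x,r)\subset U$, every affine hyperplane $\mathcal H\subset\mathbb R^d$ and every $\varepsilon>0$, $$\mu\bigl(\{z\in B(x,r):\operatorname{dist}(z,\mathcal H)<\varepsilon\}\bigr)\le C\left(\frac{\varepsilon}{r}\right)^{\alpha}\mu(B(x,r)).$$ Theorem. Let $n,d\ge 1$ be integers, $D>0$, let $U\subset\mathbb R^d$ be open, let $h_0:U\to \mathrm{SL}_{n+1}(\mathbb R)$ be a map every entry of which is real analytic, and let $\mu$ be a locally finite Borel measure on $\mathbb R^d$ which is absolutely decaying and $D$-Federer on $U$. Then for every $x_0\in\operatorname{supp}\mu\cap U$ there exist a ball $B(x_0)\subset U$ centred at $x_0$ and constants $C_0,\alpha_0>0$ such that for every ball $B\subset B(x_0)$, every diagonal matrix $g\in \mathrm{SL}_{n+1}(\mathbb R)$ and every $0<\rho\le 1$, at least one of the following holds for $h(x)=g\,h_0(x)$: (1) for all $\varepsilon>0$, $$\mu\bigl(\{x\in B: h(x)\mathbb Z^{n+1}\notin K_\varepsilon\}\bigr)\le C_0\left(\frac{\varepsilon}{\rho}\right)^{\alpha_0}\mu(3B);$$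 (2) there is a primitive collection $v_1,\dots,v_r\in\mathbb Z^{n+1}$ with $1\le r\le n$ such that $$\sup_{x\in B}\|h(x)v_1\wedge\dots\wedge h(x)v_r\|<\rho .$$ -/

import Mathlib

open MeasureTheory

noncomputable section

namespace QND

/-- Euclidean space `ℝ^k`. -/
abbrev E (k : ℕ) : Type := EuclideanSpace ℝ (Fin k)

/-- An affine hyperplane `{x : a · x = b}`, `a ≠ 0`, of `ℝ^d`. -/
def IsHyperplane {d : ℕ} (H : Set (E d)) : Prop :=
  ∃ a : E d, a ≠ 0 ∧ ∃ b : ℝ, H = {x | inner ℝ a x = b}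

/-- `μ` is `D`-Federer on `U`. -/
def IsFedererOn {d : ℕ} (μ : Measure (E d)) (D : ℝ) (U : Set (E d)) : Prop :=
  ∀ x ∈ μ.support ∩ U, ∀ r : ℝ, 0 < r → Metric.ball x (3 * r) ⊆ U →
    μ (Metric.ball x (3 * r)) < ENNReal.ofReal D * μ (Metric.ball x r)

/-- `μ` is absolutely `(C, α)`-decaying on `U`. Here `Metric.thickening ε H` is the open
`ε`-neighbourhood of `H`. -/
def IsAbsDecayingOnWith {d : ℕ} (μ : Measure (E d)) (C α : ℝ) (U : Set (E d)) : Prop :=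
  ∀ x ∈ μ.support, ∀ r : ℝ, 0 < r → Metric.ball x r ⊆ U →
    ∀ H : Set (E d), IsHyperplane H → ∀ ε : ℝ, 0 < ε →
      μ (Metric.ball x r ∩ Metric.thickening ε H) ≤
        ENNReal.ofReal (C * (ε / r) ^ α) * μ (Metric.ball x r)

/-- `μ` is absolutely decaying on `U`. -/
def IsAbsDecayingOn {d : ℕ} (μ : Measure (E d)) (U : Set (E d)) : Prop :=
  ∃ C α : ℝ, 0 < C ∧ 0 < α ∧ IsAbsDecayingOnWith μ C α U

/-- The inclusion `ℤ^k → ℝ^k`. -/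
def intVec (k : ℕ) : (Fin k → ℤ) →+ E k where
  toFun v := WithLp.toLp 2 fun i => (v i : ℝ)
  map_zero' := by ext i; simp
  map_add' v w := by ext i; simp

/-- The action of `g ∈ SL_k(ℝ)` on (column) vectors of `ℝ^k`. -/
def act {k : ℕ} (g : Matrix.SpecialLinearGroup (Fin k) ℝ) : E k →ₗ[ℝ] E k :=
  Matrix.toEuclideanLin (g : Matrix (Fin k) (Fin k) ℝ)

/-- The unimodular lattice `g ℤ^k`. -/
def lattice {k : ℕ} (g : Matrix.SpecialLinearGroup (Fin k) ℝ) : AddSubgroup (E k) :=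
  (intVec k).range.map (act g).toAddMonoidHom

/-- The set of all unimodular lattices `g ℤ^k`, `g ∈ SL_k(ℝ)`, in `ℝ^k`. -/
def unimodularLattices (k : ℕ) : Set (AddSubgroup (E k)) :=
  Set.range fun g : Matrix.SpecialLinearGroup (Fin k) ℝ => lattice g

/-- The set `K_ε` of unimodular lattices all of whose nonzero vectors have Euclidean norm at
least `ε`. -/
def K (k : ℕ) (ε : ℝ) : Set (AddSubgroup (E k)) :=
  {Λ | Λ ∈ unimodularLattices k ∧ ∀ v ∈ Λ, v ≠ 0 → ε ≤ ‖v‖}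

/-- A collection `v_1, …, v_r ∈ ℤ^k` is primitive if it is linearly independent and its integer
span is the set of all integer points of its real span. -/
def IsPrimitive {k r : ℕ} (v : Fin r → Fin k → ℤ) : Prop :=
  LinearIndependent ℝ (fun i => intVec k (v i)) ∧
    (Submodule.span ℤ (Set.range fun i => intVec k (v i)) : Set (E k)) =
      Set.range (intVec k) ∩ (Submodule.span ℝ (Set.range fun i => intVec k (v i)) : Set (E k))

/-- The multivector `g v_1 ∧ ⋯ ∧ g v_r` in the `r`-th exterior power of `ℝ^k`. That space carries
the Euclidean structure for which the vectors `e_{i_1} ∧ ⋯ ∧ e_{i_r}`, `i_1 < ⋯ < i_r`, are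
orthonormal. -/
def wedge {k r : ℕ} (g : Matrix.SpecialLinearGroup (Fin k) ℝ) (v : Fin r → Fin k → ℤ) :
    ⋀[ℝ]^r (E k) :=
  exteriorPower.ιMulti ℝ r fun i => act g (intVec k (v i))

end QND

end

/-! For a rational subspace `V` let `ψ V x` be the covolume of `h(x)(V ∩ ℤ^{n+1})`, the norm of the
wedge of an integral basis. If (2) fails, every `ψ V` with `V` proper and nonzero reaches `ρ / 2`
somewhere on the ball. Two independent facts then give (1).

Marking. Adjoining an integer vector `w` outside `V` multiplies the covolume by at most `‖h(x)w‖`.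
Suppose that at `x` a flag has covolumes in `[ε, ρ]`, with `ρ ≤ 1`, and every other proper nonzero
subspace comparable with the whole flag has covolume at least `ρ`. Adjoin `w` to the largest member
of the flag (or `⊥`) missing it: the sum is comparable with the flag, so its covolume is at least
`ε`, whence `‖h(x)w‖ ≥ ε` (`le_norm_act_of_marked`). Unmarked points are rare
(`measure_not_marked_le`): near each one some `ψ t` stays below `ρ` on a ball while every `ψ t'`
reaches `ρ` on the tripled ball. Off `{ψ t < ε}`, a flag among the subspaces comparable with `t`
extends by `t`, so induction on the number of available dimensions applies, and a Vitali covering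
with the Federer condition adds up the local bounds.

Good functions. The sets `{ψ V < ε}` must be small uniformly in `V` and `g`. Since `g` is diagonal,
each coordinate of the wedge is a linear functional of the minors of `h₀`, so one finite-dimensional
family of analytic functions suffices. Compactness modulo the functionals that vanish identically
bounds some derivative of order at most `l` from below. Where a derivative is small but the next one
is large, a sublevel set is locally close to a hyperplane and the decay of `μ` applies; descending
through the orders yields the exponent `α / 4 ^ l` (`exists_good_constants`). -/

noncomputable section

namespace QND

open Metric Set

/-! ### Coverings and marked points -/

/-- Covering estimate for a doubling measure: bounds on small balls centred in the support
give a bound on the whole set. -/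
lemma measure_le_of_local_bound {d : ℕ} {μ : Measure (E d)} {U : Set (E d)} {Δ κ : ENNReal}
    (hfed : ∀ x ∈ μ.support, ∀ r : ℝ, 0 < r → ball x (3 * r) ⊆ U →
      μ (ball x (3 * r)) ≤ Δ * μ (ball x r))
    {y : E d} {s : ℝ} {Z : Set (E d)} (hZ : Z ⊆ ball y s)
    (hr : ∀ z ∈ Z, z ∈ μ.support → ∃ r : ℝ, 0 < r ∧ r ≤ 2 * s ∧ ball z (9 * r) ⊆ U ∧
      μ (Z ∩ ball z r) ≤ κ * μ (ball z (9 * r))) :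
    μ Z ≤ κ * Δ ^ 4 * μ (ball y (3 * s)) := by
  choose! r hr0 hrs hrU hrμ using hr
  -- With radii `r / 9`, the fivefold enlargements stay inside the balls of radius `r`, and passing
  -- from `r / 9` to `9 r` costs four triplings, hence `Δ ^ 4`.
  obtain ⟨u, hu, hdisj, hcov⟩ := Vitali.exists_disjoint_subfamily_covering_enlargement_closedBall
    (Z ∩ μ.support) id (fun z => r z / 9) (2 * s / 9)
    (fun z hz => by have := hrs z hz.1 hz.2; linarith) 5 (by norm_num)
  have hu0 : ∀ z ∈ u, 0 < r z := fun z hz => hr0 z (hu hz).1 (hu hz).2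
  have hcount : u.Countable := hdisj.countable_of_nonempty_interior fun z hz =>
    ⟨z, ball_subset_interior_closedBall (mem_ball_self (by have := hu0 z hz; positivity))⟩
  have hZu : Z ∩ μ.support ⊆ ⋃ z ∈ u, Z ∩ ball z (r z) := by
    intro z hz
    obtain ⟨b, hb, hzb⟩ := hcov z hz
    have h1 := hzb (mem_closedBall_self (by have := hr0 z hz.1 hz.2; positivity))
    refine mem_biUnion hb ⟨hz.1, ?_⟩
    rw [mem_closedBall] at h1
    rw [mem_ball]
    have := hu0 b hb
    simp only [id] at h1
    linarith
  have hfour : ∀ z ∈ u, μ (ball z (9 * r z)) ≤ Δ ^ 4 * μ (ball z (r z / 9)) := by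
    intro z hz
    have h0 := hu0 z hz
    have hz' := hu hz
    have key : ∀ t, 0 < t → t ≤ 3 * r z → μ (ball z (3 * t)) ≤ Δ * μ (ball z t) :=
      fun t ht ht' => hfed z hz'.2 t ht
        ((ball_subset_ball (by linarith)).trans (hrU z hz'.1 hz'.2))
    have k1 := key (3 * r z) (by linarith) le_rfl
    have k2 := key (r z) h0 (by linarith)
    have k3 := key (r z / 3) (by linarith) (by linarith)
    have k4 := key (r z / 9) (by linarith) (by linarith)
    rw [show 3 * (3 * r z) = 9 * r z by ring] at k1
    rw [show 3 * (r z / 3) = r z by ring] at k3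
    rw [show 3 * (r z / 9) = r z / 3 by ring] at k4
    calc μ (ball z (9 * r z)) ≤ Δ * (Δ * (Δ * (Δ * μ (ball z (r z / 9))))) := by
          refine k1.trans ?_
          gcongr
          refine k2.trans ?_
          gcongr
          refine k3.trans ?_
          gcongr
      _ = _ := by ring
  have hdisj' : u.PairwiseDisjoint fun z => ball z (r z / 9) :=
    hdisj.mono fun z => ball_subset_closedBall
  have hnull : μ (Z \ μ.support) = 0 :=
    measure_mono_null (fun z hz => hz.2) Measure.measure_compl_support
  calc μ Z ≤ μ (Z ∩ μ.support) + μ (Z \ μ.support) := by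
        rw [← inter_union_sdiff Z μ.support]
        simpa using measure_union_le (Z ∩ μ.support) (Z \ μ.support)
    _ = μ (Z ∩ μ.support) := by rw [hnull, add_zero]
    _ ≤ μ (⋃ z ∈ u, Z ∩ ball z (r z)) := measure_mono hZu
    _ ≤ ∑' z : u, μ (Z ∩ ball z (r z)) := measure_biUnion_le μ hcount _
    _ ≤ ∑' z : u, κ * Δ ^ 4 * μ (ball (z : E d) (r z / 9)) := by
        refine ENNReal.tsum_le_tsum fun z => ?_
        refine (hrμ z (hu z.2).1 (hu z.2).2).trans ?_
        rw [mul_assoc]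
        gcongr
        exact hfour z z.2
    _ = κ * Δ ^ 4 * μ (⋃ z ∈ u, ball z (r z / 9)) := by
        rw [ENNReal.tsum_mul_left, measure_biUnion hcount hdisj' fun z _ => measurableSet_ball]
    _ ≤ κ * Δ ^ 4 * μ (ball y (3 * s)) := by
        gcongr
        refine iUnion₂_subset fun z hz => ?_
        have h1 := hZ (hu hz).1
        have h2 := hrs z (hu hz).1 (hu hz).2
        have h3 := hu0 z hz
        rw [mem_ball] at h1
        refine ball_subset_ball' ?_
        linarith

/-- `x` is marked for the family `T`: some flag `F ⊆ T` has `ε ≤ ψ ≤ ρ` on `F` and `ψ ≥ ρ` on every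
other element of `T` comparable with all of `F`. -/
def Marked {S : Type*} [LE S] {X : Type*} (ψ : S → X → ℝ) (ε ρ : ℝ) (T : Set S) (x : X) : Prop :=
  ∃ F ⊆ T, (∀ s ∈ F, ∀ t ∈ F, s ≤ t ∨ t ≤ s) ∧ (∀ s ∈ F, ε ≤ ψ s x ∧ ψ s x ≤ ρ) ∧
    ∀ s ∈ T, s ∉ F → (∀ t ∈ F, s ≤ t ∨ t ≤ s) → ρ ≤ ψ s x

/-- Anything in `T` comparable with `t` and with `F` already lies in the subfamily or equals `t`, so
adding `t` to the flag creates no new condition of the form `ρ ≤ ψ`. -/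
lemma Marked.insert {S : Type*} [PartialOrder S] {X : Type*} {ψ : S → X → ℝ} {ε ρ : ℝ} {T : Set S}
    {x : X} {t : S} (ht : t ∈ T) (hε : ε ≤ ψ t x) (hρ : ψ t x ≤ ρ)
    (h : Marked ψ ε ρ {s | s ∈ T ∧ (s ≤ t ∨ t ≤ s) ∧ s ≠ t} x) : Marked ψ ε ρ T x := by
  obtain ⟨F, hF, hchain, hval, hbig⟩ := h
  refine ⟨Insert.insert t F, insert_subset ht fun s hs => (hF hs).1, ?_, ?_, ?_⟩
  · rintro s (rfl | hs) s' (rfl | hs')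
    · exact Or.inl le_rfl
    · exact (hF hs').2.1.symm
    · exact (hF hs).2.1
    · exact hchain s hs s' hs'
  · rintro s (rfl | hs)
    · exact ⟨hε, hρ⟩
    · exact hval s hs
  · intro s hs hsF hcomp
    rw [mem_insert_iff, not_or] at hsF
    exact hbig s ⟨hs, hcomp t (mem_insert t F), hsF.1⟩ hsF.2
      fun s' hs' => hcomp s' (mem_insert_of_mem t hs')

/-- A point where some `ψ t` is small has a radius `r` on which one `ψ t` stays small while on the
ball of radius `3 r` every `ψ t'` gets large. -/
lemma exists_critical_radius {d : ℕ} {S : Type*} {ψ : S → E d → ℝ} {ρ s : ℝ}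
    {W : Set (E d)} (hW : IsOpen W) (hψ : ∀ t, ContinuousOn (ψ t) W) {T : Set S} {y x : E d}
    (hx : x ∈ ball y s) (hxW : x ∈ W) (hlarge : ∀ t ∈ T, ∃ w ∈ ball y s, ρ ≤ ψ t w)
    (hsmall : ∃ t ∈ T, ψ t x < ρ) :
    ∃ t ∈ T, ∃ r : ℝ, 0 < r ∧ r ≤ 2 * s ∧ (∀ w ∈ ball x r, ψ t w < ρ) ∧
      ∀ t' ∈ T, ∃ w ∈ ball x (3 * r), ρ ≤ ψ t' w := by
  set Q : Set ℝ := {r | 0 < r ∧ ∃ t ∈ T, ∀ w ∈ ball x r, ψ t w < ρ} with hQ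
  have hbdd : ∀ r ∈ Q, r ≤ 2 * s := by
    rintro r ⟨-, t, ht, hlt⟩
    by_contra! hlt'
    obtain ⟨w, hw, hw'⟩ := hlarge t ht
    refine absurd (hlt w ?_) (not_lt.2 hw')
    rw [mem_ball] at *
    linarith [dist_triangle_right w x y]
  have hne : Q.Nonempty := by
    obtain ⟨t, ht, htx⟩ := hsmall
    have h1 : ∀ᶠ w in nhds x, ψ t w < ρ :=
      ((hψ t).continuousAt (hW.mem_nhds hxW)).eventually_lt_const htx
    obtain ⟨r, hr, hball⟩ := Metric.eventually_nhds_iff_ball.1 h1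
    exact ⟨r, hr, t, ht, hball⟩
  have hbdd' : BddAbove Q := ⟨2 * s, hbdd⟩
  have hpos : 0 < sSup Q := by
    obtain ⟨r, hr⟩ := hne
    exact hr.1.trans_le (le_csSup hbdd' hr)
  -- A radius above a third of the supremum belongs to `Q` while its triple does not.
  obtain ⟨r, hr, hrlt⟩ := exists_lt_of_lt_csSup hne (show sSup Q / 3 < sSup Q by linarith)
  obtain ⟨hr0, t, ht, hlt⟩ := id hr
  refine ⟨t, ht, r, hr0, hbdd r hr, hlt, fun t' ht' => ?_⟩
  by_contra! hcon
  have := le_csSup hbdd' (show 3 * r ∈ Q from ⟨by linarith, t', ht', hcon⟩)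
  linarith

/-- Quantitative nondivergence for a family indexed by a ranked poset. -/
theorem measure_not_marked_le {d : ℕ} {μ : Measure (E d)} {U W : Set (E d)} {Δ κ : ENNReal}
    (hfed : ∀ x ∈ μ.support, ∀ r : ℝ, 0 < r → ball x (3 * r) ⊆ U →
      μ (ball x (3 * r)) ≤ Δ * μ (ball x r))
    (hW : IsOpen W) (hWU : W ⊆ U)
    {S : Type*} [PartialOrder S] (rk : S → ℕ) (hrk : ∀ s t, s ≤ t → rk s = rk t → s = t)
    {ψ : S → E d → ℝ} (hψ : ∀ t, ContinuousOn (ψ t) W) {ε ρ : ℝ}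
    (hgood : ∀ t, ∀ y : E d, ∀ s : ℝ, 0 < s → ball y (30 * s) ⊆ W → (∃ w ∈ ball y s, ρ ≤ ψ t w) →
      μ (ball y s ∩ {x | ψ t x < ε}) ≤ κ * μ (ball y (3 * s)))
    (m : ℕ) :
    ∀ (T : Set S) (A : Finset ℕ), A.card ≤ m → (∀ t ∈ T, rk t ∈ A) →
      ∀ y : E d, ∀ s : ℝ, ball y (30 * 7 ^ m * s) ⊆ W → (∀ t ∈ T, ∃ w ∈ ball y s, ρ ≤ ψ t w) →
      μ {x | x ∈ ball y s ∧ ¬ Marked ψ ε ρ T x} ≤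
        (∑ i ∈ Finset.range m, (Δ ^ 4) ^ (i + 1)) * κ * μ (ball y (3 * s)) := by
  have hempty : ∀ (T : Set S) (x : E d), (∀ t ∈ T, ρ ≤ ψ t x) → Marked ψ ε ρ T x :=
    fun T x h => ⟨∅, empty_subset _, by simp, by simp, fun s hs _ _ => h s hs⟩
  induction m with
  | zero =>
    intro T A hA hT y s _ _
    have hTe : ∀ t ∈ T, False := fun t ht => by
      have := hT t ht
      rw [Finset.card_eq_zero.1 (Nat.le_zero.1 hA)] at this
      simp at this
    have : {x | x ∈ ball y s ∧ ¬ Marked ψ ε ρ T x} = ∅ := by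
      ext x
      simpa using fun _ => hempty T x fun t ht => (hTe t ht).elim
    rw [this]
    simp
  | succ m ih =>
    intro T A hA hT y s hyW hlarge
    have h7 : (1 : ℝ) ≤ 7 ^ m := one_le_pow₀ (by norm_num)
    -- The recursion `c (m + 1) = (1 + c m) Δ ^ 4`: the `1` pays for `ψ t < ε`, `c m` for the
    -- induction hypothesis, `Δ ^ 4` for the covering.
    have hsum : (∑ i ∈ Finset.range (m + 1), (Δ ^ 4) ^ (i + 1)) * κ =
        (κ + (∑ i ∈ Finset.range m, (Δ ^ 4) ^ (i + 1)) * κ) * Δ ^ 4 := by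
      rw [Finset.sum_range_succ']
      simp only [pow_succ _ (_ + 1), ← Finset.sum_mul]
      ring
    rw [hsum]
    refine measure_le_of_local_bound hfed (fun x hx => hx.1) ?_
    rintro z ⟨hz, hzM⟩ -
    have hs : 0 < s := pos_of_mem_ball hz
    rw [pow_succ] at hyW
    have hsmall : ∃ t ∈ T, ψ t z < ρ := by
      by_contra! hcon
      exact hzM (hempty T z hcon)
    have hzW : z ∈ W := hyW (ball_subset_ball (by nlinarith) hz)
    obtain ⟨t, ht, r, hr0, hrs, hlt, hlarge'⟩ :=
      exists_critical_radius hW hψ hz hzW hlarge hsmall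
    -- The base 7: induction runs on radius `3 r ≤ 6 s`, and the centre moves by less than `s`.
    have hsub : ∀ q, q ≤ 30 * (7 ^ m * 7) * s - s → ball z q ⊆ W := fun q hq =>
      (ball_subset_ball' (by rw [mem_ball] at hz; linarith)).trans hyW
    refine ⟨r, hr0, hrs, (hsub _ (by nlinarith)).trans hWU, ?_⟩
    have h1 := hgood t z (3 * r) (by linarith) (hsub _ (by nlinarith)) (hlarge' t ht)
    -- Elements comparable with `t` and distinct from it have a different rank, so one rank is used
    -- up.
    have h2 := ih {t' | t' ∈ T ∧ (t' ≤ t ∨ t ≤ t') ∧ t' ≠ t} (A.erase (rk t))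
      (by rw [Finset.card_erase_of_mem (hT t ht)]; omega)
      (fun t' ht' => Finset.mem_erase.2 ⟨fun heq => ht'.2.2 <| by
        rcases ht'.2.1 with h | h
        · exact hrk _ _ h heq
        · exact (hrk _ _ h heq.symm).symm, hT t' ht'.1⟩)
      z (3 * r) (hsub _ (by nlinarith [mul_le_mul_of_nonneg_left hrs (by positivity : (0:ℝ) ≤ 7 ^ m)]))
      (fun t' ht' => hlarge' t' ht'.1)
    rw [show 3 * (3 * r) = 9 * r by ring] at h1 h2
    have hsub' : {x | x ∈ ball y s ∧ ¬ Marked ψ ε ρ T x} ∩ ball z r ⊆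
        (ball z (3 * r) ∩ {x | ψ t x < ε}) ∪ {x | x ∈ ball z (3 * r) ∧
          ¬ Marked ψ ε ρ {t' | t' ∈ T ∧ (t' ≤ t ∨ t ≤ t') ∧ t' ≠ t} x} := by
      rintro x ⟨⟨-, hxM⟩, hxr⟩
      have hx3 : x ∈ ball z (3 * r) := ball_subset_ball (by linarith) hxr
      by_cases hxε : ψ t x < ε
      · exact Or.inl ⟨hx3, hxε⟩
      · exact Or.inr ⟨hx3, fun hM => hxM (hM.insert ht (not_lt.1 hxε) (hlt x hxr).le)⟩
    calc _ ≤ _ := measure_mono hsub'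
      _ ≤ _ := measure_union_le _ _
      _ ≤ _ := add_le_add h1 h2
      _ = _ := by ring

/-! ### Sublevel sets from derivative bounds -/

/-- A function with bounded second derivative is rarely small where its gradient is large, for an
absolutely decaying doubling measure. -/
lemma measure_small_with_large_derivative_le {d : ℕ} {μ : Measure (E d)} {U : Set (E d)}
    {Δ : ENNReal}
    (hfed : ∀ x ∈ μ.support, ∀ r : ℝ, 0 < r → ball x (3 * r) ⊆ U →
      μ (ball x (3 * r)) ≤ Δ * μ (ball x r))
    {C α : ℝ} (hdec : IsAbsDecayingOnWith μ C α U)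
    {F : Type*} [NormedAddCommGroup F] [NormedSpace ℝ F] {G : E d → F} {G' : E d → E d →L[ℝ] F}
    {y : E d} {s A K τ : ℝ} (hs : 0 < s) (hA : 0 < A) (hK : 0 ≤ K) (hτ : 0 < τ) (hτ1 : τ ≤ 1)
    (hyU : ball y (10 * s) ⊆ U)
    (htaylor : ∀ z ∈ ball y (2 * s), ∀ w ∈ ball y (2 * s),
      ‖G w - G z - G' z (w - z)‖ ≤ K * A / s ^ 2 * ‖w - z‖ * ‖w - z‖) :
    μ {z | z ∈ ball y s ∧ ‖G z‖ < τ ^ 4 * A ∧ τ * A / s ≤ ‖G' z‖} ≤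
      ENNReal.ofReal (C * ((4 + 2 * K) * τ) ^ α) * Δ ^ 4 * μ (ball y (3 * s)) := by
  refine measure_le_of_local_bound hfed (fun x hx => hx.1) ?_
  rintro z ⟨hz, hzG, hzG'⟩ hzs
  have hτ2 : τ ^ 2 ≤ 1 := pow_le_one₀ hτ.le hτ1
  have ht : 0 < τ ^ 2 * s := by positivity
  have hts : τ ^ 2 * s ≤ s := by nlinarith
  rw [mem_ball] at hz
  have hzU : ball z (9 * (τ ^ 2 * s)) ⊆ U := (ball_subset_ball' (by linarith)).trans hyU
  -- At radius `τ² s` the Taylor error is at most `K τ⁴ A`, comparable with the allowed size of `G`.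
  -- Dividing by the slope `τ A / (2 s)` gives a strip of width `(4 + 2 K) τ³ s`, narrower than the
  -- ball by the factor `(4 + 2 K) τ`.
  refine ⟨τ ^ 2 * s, ht, by linarith, hzU, ?_⟩
  have hδ : 0 < τ * A / s := by positivity
  -- A functional norming `G' z v`, for `v` nearly extremal, reduces to a scalar function keeping
  -- more than half of the required slope `τ A / s`.
  obtain ⟨v, hv1, hv⟩ := (G' z).exists_lt_apply_of_lt_opNorm
    (show τ * A / s / 2 < ‖G' z‖ by linarith)
  obtain ⟨φ, hφ, hφv⟩ := exists_dual_vector ℝ (G' z v) (by linarith)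
  set ℓ : E d →L[ℝ] ℝ := φ.comp (G' z) with hℓ
  have hℓn : τ * A / s / 2 < ‖ℓ‖ := by
    have h1 : ‖ℓ v‖ ≤ ‖ℓ‖ * ‖v‖ := ℓ.le_opNorm v
    have h2 : ℓ v = ‖G' z v‖ := hφv
    rw [h2, norm_norm] at h1
    nlinarith [norm_nonneg ℓ]
  set a : E d := (InnerProductSpace.toDual ℝ (E d)).symm ℓ with ha
  have han : ‖a‖ = ‖ℓ‖ := LinearIsometryEquiv.norm_map _ _
  have hin : ∀ w, inner ℝ a w = ℓ w := fun w => InnerProductSpace.toDual_symm_apply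
  have hℓ0 : 0 < ‖ℓ‖ := by linarith
  have ha0 : a ≠ 0 := norm_pos_iff.1 (by rwa [han])
  have hdecz := hdec z hzs (τ ^ 2 * s) ht ((ball_subset_ball (by linarith)).trans hzU)
    {x | inner ℝ a x = inner ℝ a z} ⟨a, ha0, _, rfl⟩ ((4 + 2 * K) * τ ^ 3 * s) (by positivity)
  have hratio : (4 + 2 * K) * τ ^ 3 * s / (τ ^ 2 * s) = (4 + 2 * K) * τ := by
    field_simp
  rw [hratio] at hdecz
  refine (measure_mono ?_).trans (hdecz.trans ?_)
  · rintro w ⟨⟨-, hwG, -⟩, hwz⟩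
    refine ⟨hwz, mem_thickening_iff.2 ⟨w - (ℓ (w - z) / ‖a‖ ^ 2) • a, ?_, ?_⟩⟩
    · have haa : ℓ a = ‖a‖ ^ 2 := by rw [← hin, real_inner_self_eq_norm_sq]
      simp only [mem_ofPred_eq, hin, map_sub, map_smul, haa, smul_eq_mul]
      have : ‖a‖ ≠ 0 := norm_ne_zero_iff.2 ha0
      field_simp
      ring
    · rw [mem_ball] at hwz
      have hT := htaylor z (by rw [mem_ball]; linarith) w
        (by rw [mem_ball]; linarith [dist_triangle w z y])
      have hwz' : ‖w - z‖ ≤ τ ^ 2 * s := by rw [← dist_eq_norm]; exact hwz.le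
      have hφle : ∀ u, |φ u| ≤ ‖u‖ := fun u => by
        simpa [hφ] using φ.le_opNorm u
      have e1 : ℓ (w - z) = φ (G w) - φ (G z) - φ (G w - G z - G' z (w - z)) := by
        simp [hℓ]
      have hM : K * A / s ^ 2 * ‖w - z‖ * ‖w - z‖ ≤ K * τ ^ 4 * A := by
        calc K * A / s ^ 2 * ‖w - z‖ * ‖w - z‖
            ≤ K * A / s ^ 2 * (τ ^ 2 * s) * (τ ^ 2 * s) := by gcongr
          _ = K * τ ^ 4 * A := by field_simp
      have habs : |ℓ (w - z)| < (2 + K) * τ ^ 4 * A := by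
        rw [e1]
        have h1 := hφle (G w)
        have h2 := hφle (G z)
        have h3 := hφle (G w - G z - G' z (w - z))
        rw [abs_le] at h1 h2 h3
        rw [abs_lt]
        constructor <;> nlinarith
      have hd : dist w (w - (ℓ (w - z) / ‖a‖ ^ 2) • a) = |ℓ (w - z)| / ‖a‖ := by
        have : ‖a‖ ≠ 0 := norm_ne_zero_iff.2 ha0
        rw [dist_eq_norm, sub_sub_cancel, norm_smul, Real.norm_eq_abs, abs_div,
          abs_of_nonneg (sq_nonneg ‖a‖)]
        field_simp
      rw [hd, han, div_lt_iff₀ hℓ0]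
      calc |ℓ (w - z)| < (2 + K) * τ ^ 4 * A := habs
        _ = (4 + 2 * K) * τ ^ 3 * s * (τ * A / s / 2) := by field_simp; ring
        _ ≤ (4 + 2 * K) * τ ^ 3 * s * ‖ℓ‖ := by gcongr
  · gcongr _ * μ ?_
    exact ball_subset_ball (by linarith)

/-- Second order Taylor estimate for the iterated derivatives of an analytic function. -/
lemma norm_taylor_iteratedFDeriv_le {V W : Type*} [NormedAddCommGroup V] [NormedSpace ℝ V]
    [NormedAddCommGroup W] [NormedSpace ℝ W] [CompleteSpace W] {f : V → W} {s : Set V}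
    (hs : Convex ℝ s) (hf : AnalyticOnNhd ℝ f s) {j : ℕ} {M : ℝ}
    (hM : ∀ z ∈ s, ‖iteratedFDeriv ℝ (j + 2) f z‖ ≤ M) {z w : V} (hz : z ∈ s) (hw : w ∈ s) :
    ‖iteratedFDeriv ℝ j f w - iteratedFDeriv ℝ j f z -
      fderiv ℝ (iteratedFDeriv ℝ j f) z (w - z)‖ ≤ M * ‖w - z‖ * ‖w - z‖ := by
  have hM0 : 0 ≤ M := (norm_nonneg _).trans (hM z hz)
  have hcd : ∀ x ∈ s, ContDiffAt ℝ ⊤ f x := fun x hx => (hf x hx).contDiffAt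
  have hd : ∀ (i : ℕ), ∀ x ∈ s, DifferentiableAt ℝ (iteratedFDeriv ℝ i f) x := fun i x hx =>
    (hcd x hx).differentiableAt_iteratedFDeriv (by exact WithTop.coe_lt_top _)
  have hseg : segment ℝ z w ⊆ s := hs.segment_subset hz hw
  have hstep : ∀ x ∈ segment ℝ z w, ‖fderiv ℝ (iteratedFDeriv ℝ j f) x -
      fderiv ℝ (iteratedFDeriv ℝ j f) z‖ ≤ M * ‖w - z‖ := by
    intro x hx
    rw [fderiv_iteratedFDeriv]
    simp only [Function.comp_apply]
    have hiso := (continuousMultilinearCurryLeftEquiv ℝ (fun _ : Fin (j + 1) => V) W).dist_map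
      (iteratedFDeriv ℝ (j + 1) f x) (iteratedFDeriv ℝ (j + 1) f z)
    rw [dist_eq_norm, dist_eq_norm] at hiso
    refine hiso.le.trans ?_
    refine (hs.norm_image_sub_le_of_norm_fderiv_le (𝕜 := ℝ) (fun x hx => hd (j + 1) x hx)
      (fun x hx => by rw [norm_fderiv_iteratedFDeriv]; exact hM x hx) hz (hseg hx)).trans ?_
    gcongr
    exact norm_sub_le_of_mem_segment hx
  exact (convex_segment z w).norm_image_sub_le_of_norm_hasFDerivWithin_le'
    (fun x hx => ((hd j x (hseg hx)).hasFDerivAt).hasFDerivWithinAt) hstep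
    (left_mem_segment ℝ z w) (right_mem_segment ℝ z w)

/-- Sublevel set estimate for an analytic function some of whose derivatives of order at most `l` is
nonzero at each point. -/
lemma measure_sublevel_le_of_derivative_bounds {d : ℕ} {μ : Measure (E d)} {U : Set (E d)}
    {Δ : ENNReal}
    (hfed : ∀ x ∈ μ.support, ∀ r : ℝ, 0 < r → ball x (3 * r) ⊆ U →
      μ (ball x (3 * r)) ≤ Δ * μ (ball x r))
    {C α : ℝ} (hC : 0 ≤ C) (hα : 0 ≤ α) (hdec : IsAbsDecayingOnWith μ C α U)
    {f : E d → ℝ} {y : E d} {s A K c τ : ℝ} (hs : 0 < s) (hA : 0 < A) (hK : 0 ≤ K)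
    (hτ : 0 < τ) (hτ1 : τ ≤ 1) (hyU : ball y (10 * s) ⊆ U)
    (hf : AnalyticOnNhd ℝ f (ball y (2 * s))) (l : ℕ)
    (hub : ∀ j ≤ l + 1, ∀ z ∈ ball y (2 * s), s ^ j * ‖iteratedFDeriv ℝ j f z‖ ≤ K * A)
    (hlb : ∀ z ∈ ball y s, c * A ≤ ∑ j ∈ Finset.range (l + 1), s ^ j * ‖iteratedFDeriv ℝ j f z‖)
    (hτc : (l + 1) * τ < c) :
    μ (ball y s ∩ {z | |f z| < τ ^ (4 ^ l) * A}) ≤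
      l * (ENNReal.ofReal (C * ((4 + 2 * K) * τ) ^ α) * Δ ^ 4 * μ (ball y (3 * s))) := by
  set p : ℕ → E d → ℝ := fun j z => s ^ j * ‖iteratedFDeriv ℝ j f z‖ with hp
  -- The threshold for order `j` is the fourth power of that for order `j + 1`, matching the
  -- previous estimate. A point in no `Z j` has all derivatives up to order `l` below threshold,
  -- against the lower bound `c * A`.
  set Z : ℕ → Set (E d) := fun j => {z | z ∈ ball y s ∧ p j z < τ ^ (4 ^ (l - j)) * A ∧
    τ ^ (4 ^ (l - (j + 1))) * A ≤ p (j + 1) z} with hZ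
  have hcover : ball y s ∩ {z | |f z| < τ ^ (4 ^ l) * A} ⊆ ⋃ j ∈ Finset.range l, Z j := by
    rintro z ⟨hz, hzf⟩
    by_contra hcon
    simp only [mem_iUnion, not_exists] at hcon
    have hall : ∀ j ≤ l, p j z < τ ^ (4 ^ (l - j)) * A := by
      intro j
      induction j with
      | zero => intro _; simpa [hp] using hzf
      | succ j ih =>
        intro hj
        by_contra! hlt
        exact hcon j (Finset.mem_range.2 (by omega)) ⟨hz, ih (by omega), hlt⟩
    have hsum : ∑ j ∈ Finset.range (l + 1), p j z ≤ ∑ j ∈ Finset.range (l + 1), τ * A := by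
      refine Finset.sum_le_sum fun j hj => (hall j (by simpa [Nat.lt_succ_iff] using hj)).le.trans ?_
      gcongr
      exact pow_le_of_le_one hτ.le hτ1 (by positivity)
    have := (hlb z hz).trans hsum
    rw [Finset.sum_const, Finset.card_range, nsmul_eq_mul] at this
    push_cast at this
    nlinarith
  have hone : ∀ j ∈ Finset.range l, μ (Z j) ≤
      ENNReal.ofReal (C * ((4 + 2 * K) * τ) ^ α) * Δ ^ 4 * μ (ball y (3 * s)) := by
    intro j hj
    rw [Finset.mem_range] at hj
    set σ := τ ^ (4 ^ (l - (j + 1))) with hσ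
    have hσ0 : 0 < σ := by positivity
    have hσ1 : σ ≤ 1 := pow_le_one₀ hτ.le hτ1
    have hσ4 : σ ^ 4 = τ ^ (4 ^ (l - j)) := by
      rw [hσ, ← pow_mul, ← pow_succ, show l - (j + 1) + 1 = l - j by omega]
    have hmain := measure_small_with_large_derivative_le (G := iteratedFDeriv ℝ j f)
      (G' := fderiv ℝ (iteratedFDeriv ℝ j f)) (A := A / s ^ j) hfed hdec hs (by positivity) hK
      hσ0 hσ1 hyU (fun z hz w hw => norm_taylor_iteratedFDeriv_le (convex_ball y (2 * s)) hf
        (fun z hz => by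
          have := hub (j + 2) (by omega) z hz
          rw [show K * (A / s ^ j) / s ^ 2 = K * A / s ^ (j + 2) by
            rw [pow_add]; field_simp]
          rw [le_div_iff₀ (by positivity)]
          linarith) hz hw)
    refine (measure_mono ?_).trans (hmain.trans ?_)
    · rintro z ⟨hz, h1, h2⟩
      refine ⟨hz, ?_, ?_⟩
      · rw [hσ4, ← mul_div_assoc, lt_div_iff₀ (by positivity)]
        linarith
      · rw [norm_fderiv_iteratedFDeriv]
        rw [show σ * (A / s ^ j) / s = σ * A / s ^ (j + 1) by
          rw [pow_succ]; field_simp,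
          div_le_iff₀ (by positivity)]
        linarith
    · gcongr
      exact pow_le_of_le_one hτ.le hτ1 (by positivity)
  calc _ ≤ μ (⋃ j ∈ Finset.range l, Z j) := measure_mono hcover
    _ ≤ ∑ j ∈ Finset.range l, μ (Z j) := measure_biUnion_finset_le _ _
    _ ≤ ∑ j ∈ Finset.range l, _ := Finset.sum_le_sum hone
    _ = _ := by rw [Finset.sum_const, Finset.card_range, nsmul_eq_mul]

/-! ### Uniform goodness of analytic families -/

/-- The linear combinations of the components of an analytic map are uniformly nondegenerate near
each point. -/
lemma exists_uniform_nondegeneracy {X V : Type*} [NormedAddCommGroup X] [NormedSpace ℝ X]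
    [NormedAddCommGroup V] [NormedSpace ℝ V]
    [FiniteDimensional ℝ V] {g : X → V} {x₀ : X} (hg : AnalyticAt ℝ g x₀) :
    ∃ R : ℝ, 0 < R ∧ ∃ l : ℕ, ∃ M : ℝ, 0 < M ∧ AnalyticOnNhd ℝ g (ball x₀ R) ∧
      ∀ L : V →L[ℝ] ℝ, ∀ z ∈ ball x₀ R, ∀ z' ∈ ball x₀ R,
        ‖iteratedFDeriv ℝ (l + 1) (L ∘ g) z'‖ ≤
          M * ∑ j ∈ Finset.range (l + 1), ‖iteratedFDeriv ℝ j (L ∘ g) z‖ := by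
  have hcomplete : CompleteSpace V := FiniteDimensional.complete ℝ V
  have : ProperSpace (V →L[ℝ] ℝ) := FiniteDimensional.proper_real _
  obtain ⟨R₁, hR₁, hg₁⟩ := Metric.eventually_nhds_iff_ball.1 hg.eventually_analyticAt
  have hLg : ∀ L : V →L[ℝ] ℝ, AnalyticOnNhd ℝ (L ∘ g) (ball x₀ R₁) := fun L z hz =>
    (L.analyticAt _).comp (hg₁ z hz)
  have hder : ∀ (L : V →L[ℝ] ℝ) (j : ℕ), ∀ z ∈ ball x₀ R₁, iteratedFDeriv ℝ j (L ∘ g) z =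
      L.compContinuousMultilinearMap (iteratedFDeriv ℝ j g z) := fun L j z hz =>
    L.iteratedFDeriv_comp_left ((hg₁ z hz).contDiffAt (n := j)) le_rfl
  -- the functionals killing the germ of `g`, and a complement
  let N : Submodule ℝ (V →L[ℝ] ℝ) :=
    { carrier := {L | ∀ z ∈ ball x₀ R₁, L (g z) = 0}
      add_mem' := fun {a b} ha hb z hz => by simp [ha z hz, hb z hz]
      zero_mem' := fun z _ => by simp
      smul_mem' := fun c a ha z hz => by simp [ha z hz] }
  obtain ⟨N', hN'⟩ := Submodule.exists_isCompl N
  -- If all derivatives vanish at `x₀`, the power series and then the identity theorem make `L ∘ g`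
  -- zero on the ball.
  have hnonzero : ∀ L : V →L[ℝ] ℝ, L ∉ N → ∃ j, iteratedFDeriv ℝ j (L ∘ g) x₀ ≠ 0 := by
    intro L hL
    by_contra! hcon
    refine hL ?_
    obtain ⟨q, r, hq⟩ := hLg L x₀ (mem_ball_self hR₁)
    have hev : (L ∘ g) =ᶠ[nhds x₀] 0 := by
      refine Filter.eventually_of_mem (Metric.eball_mem_nhds x₀ hq.r_pos) fun z hz => ?_
      have hsum := hq.hasSum_iteratedFDeriv (y := z - x₀) (by
        simpa [Metric.mem_eball, edist_eq_enorm_sub] using hz)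
      simp only [hcon, add_sub_cancel] at hsum
      simpa using hsum.unique (by simp)
    exact fun z hz => (hLg L).eqOn_zero_of_preconnected_of_eventuallyEq_zero
      (convex_ball x₀ R₁).isPreconnected (mem_ball_self hR₁) hev hz
  have hcont : ∀ (j : ℕ) (L : V →L[ℝ] ℝ), ContinuousAt (fun p : X × (V →L[ℝ] ℝ) =>
      ‖p.2.compContinuousMultilinearMap (iteratedFDeriv ℝ j g p.1)‖) (x₀, L) := by
    intro j L
    have h1 : ContinuousAt (iteratedFDeriv ℝ j g) x₀ :=
      (hg.contDiffAt (n := j)).continuousAt_iteratedFDeriv le_rfl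
    have h2 : ContinuousAt (fun p : X × (V →L[ℝ] ℝ) => iteratedFDeriv ℝ j g p.1) (x₀, L) :=
      ContinuousAt.comp (f := Prod.fst) (x := (x₀, L)) h1 continuousAt_fst
    exact ((((ContinuousLinearMap.compContinuousMultilinearMapL ℝ (fun _ : Fin j => X) V ℝ).continuous.continuousAt.comp
      continuousAt_snd).clm_apply h2)).norm
  have hcompact : IsCompact ((N' : Set (V →L[ℝ] ℝ)) ∩ sphere 0 1) :=
    (isCompact_sphere 0 1).inter_left N'.closed_of_finiteDimensional
  -- The order needed depends on the functional; compactness makes it uniform, taking the larger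
  -- order and the smaller constant for unions.
  have hlower : ∃ l : ℕ, ∃ c : ℝ, 0 < c ∧ ∀ᶠ z in nhds x₀,
      ∀ L ∈ (N' : Set (V →L[ℝ] ℝ)) ∩ sphere 0 1, c < ∑ j ∈ Finset.range (l + 1),
        ‖L.compContinuousMultilinearMap (iteratedFDeriv ℝ j g z)‖ := by
    refine hcompact.induction_on (p := fun s => ∃ l : ℕ, ∃ c : ℝ, 0 < c ∧ ∀ᶠ z in nhds x₀,
      ∀ L ∈ s, c < ∑ j ∈ Finset.range (l + 1),
        ‖L.compContinuousMultilinearMap (iteratedFDeriv ℝ j g z)‖) ?_ ?_ ?_ ?_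
    · exact ⟨0, 1, one_pos, by simp⟩
    · rintro s t hst ⟨l, c, hc, h⟩
      exact ⟨l, c, hc, h.mono fun z hz L hL => hz L (hst hL)⟩
    · rintro s t ⟨l, c, hc, h⟩ ⟨l', c', hc', h'⟩
      refine ⟨max l l', min c c', lt_min hc hc', ?_⟩
      filter_upwards [h, h'] with z hz hz'
      have hmono : ∀ a b : ℕ, a ≤ b → ∀ L : V →L[ℝ] ℝ,
          ∑ j ∈ Finset.range (a + 1), ‖L.compContinuousMultilinearMap (iteratedFDeriv ℝ j g z)‖ ≤
          ∑ j ∈ Finset.range (b + 1), ‖L.compContinuousMultilinearMap (iteratedFDeriv ℝ j g z)‖ :=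
        fun a b hab L => Finset.sum_le_sum_of_subset_of_nonneg
          (Finset.range_mono (by omega)) fun _ _ _ => norm_nonneg _
      rintro L (hL | hL)
      · exact (min_le_left _ _).trans_lt ((hz L hL).trans_le (hmono _ _ (le_max_left _ _) L))
      · exact (min_le_right _ _).trans_lt ((hz' L hL).trans_le (hmono _ _ (le_max_right _ _) L))
    · rintro L ⟨hLN', hL1⟩
      have hLN : L ∉ N := fun hLN => by
        have := (Submodule.disjoint_def.1 hN'.disjoint) L hLN hLN'
        simp [this] at hL1
      obtain ⟨j, hj⟩ := hnonzero L hLN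
      rw [hder L j x₀ (mem_ball_self hR₁)] at hj
      have hpos := norm_pos_iff.2 hj
      have hev := (hcont j L).eventually_const_lt (half_lt_self hpos)
      rw [nhds_prod_eq, Filter.eventually_prod_iff] at hev
      obtain ⟨pa, hpa, pb, hpb, hab⟩ := hev
      refine ⟨{L' | pb L'}, mem_nhdsWithin_of_mem_nhds hpb, j, _, half_pos hpos, ?_⟩
      filter_upwards [hpa] with z hz L' hL'
      exact (hab hz hL').trans_le (Finset.single_le_sum
        (f := fun j => ‖L'.compContinuousMultilinearMap (iteratedFDeriv ℝ j g z)‖)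
        (fun _ _ => norm_nonneg _) (Finset.self_mem_range_succ j))
  obtain ⟨l, c, hc, hlow⟩ := hlower
  have hupper : ∀ᶠ z in nhds x₀, ‖iteratedFDeriv ℝ (l + 1) g z‖ <
      ‖iteratedFDeriv ℝ (l + 1) g x₀‖ + 1 :=
    ((hg.contDiffAt (n := (l + 1 : ℕ))).continuousAt_iteratedFDeriv le_rfl).norm.eventually_lt_const
      (lt_add_one _)
  obtain ⟨R₂, hR₂, hball⟩ := Metric.eventually_nhds_iff_ball.1 (hlow.and hupper)
  set B := ‖iteratedFDeriv ℝ (l + 1) g x₀‖ + 1 with hB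
  have hB0 : 0 < B := by positivity
  refine ⟨min R₁ R₂, lt_min hR₁ hR₂, l, B / c, by positivity,
    fun z hz => hg₁ z (ball_subset_ball (min_le_left _ _) hz), ?_⟩
  intro L z hz z' hz'
  -- The component in `N` contributes nothing to any derivative, so only `N'` matters.
  obtain ⟨k, hk, k', hk', rfl⟩ := Submodule.mem_sup.1
    (hN'.sup_eq_top ▸ Submodule.mem_top : L ∈ N ⊔ N')
  have hreduce : ∀ (j : ℕ), ∀ w ∈ ball x₀ R₁,
      iteratedFDeriv ℝ j ((k + k') ∘ g) w = iteratedFDeriv ℝ j (k' ∘ g) w := by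
    intro j w hw
    refine (Filter.EventuallyEq.iteratedFDeriv ℝ ?_ j).eq_of_nhds
    filter_upwards [isOpen_ball.mem_nhds hw] with u hu
    simp [hk u hu]
  have hz1 := ball_subset_ball (min_le_left R₁ R₂) hz
  have hz2 := ball_subset_ball (min_le_right R₁ R₂) hz
  have hz1' := ball_subset_ball (min_le_left R₁ R₂) hz'
  have hz2' := ball_subset_ball (min_le_right R₁ R₂) hz'
  simp only [FunLike.coe_add] at hreduce ⊢
  rw [hreduce _ z' hz1', hder k' _ z' hz1']
  simp only [hreduce _ z hz1, hder k' _ z hz1]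
  have h1 : ‖k'.compContinuousMultilinearMap (iteratedFDeriv ℝ (l + 1) g z')‖ ≤ ‖k'‖ * B :=
    (k'.norm_compContinuousMultilinearMap_le _).trans (by gcongr; exact (hball z' hz2').2.le)
  have h2 : c * ‖k'‖ ≤ ∑ j ∈ Finset.range (l + 1),
      ‖k'.compContinuousMultilinearMap (iteratedFDeriv ℝ j g z)‖ := by
    rcases eq_or_ne k' 0 with rfl | hk0
    · simpa using Finset.sum_nonneg fun _ _ => norm_nonneg _
    have hkn : 0 < ‖k'‖ := norm_pos_iff.2 hk0
    have h3 := (hball z hz2).1 (‖k'‖⁻¹ • k') ⟨N'.smul_mem _ hk', by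
      simp [norm_smul, hkn.ne']⟩
    have h4 : ∀ j, ‖(‖k'‖⁻¹ • k').compContinuousMultilinearMap (iteratedFDeriv ℝ j g z)‖ =
        ‖k'‖⁻¹ * ‖k'.compContinuousMultilinearMap (iteratedFDeriv ℝ j g z)‖ := fun j => by
      have : (‖k'‖⁻¹ • k').compContinuousMultilinearMap (iteratedFDeriv ℝ j g z) =
          ‖k'‖⁻¹ • k'.compContinuousMultilinearMap (iteratedFDeriv ℝ j g z) := by
        ext; simp
      rw [this, norm_smul, norm_inv, norm_norm]
    simp only [h4, ← Finset.mul_sum] at h3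
    rw [inv_mul_eq_div, lt_div_iff₀ hkn] at h3
    exact h3.le
  calc _ ≤ ‖k'‖ * B := h1
    _ = B / c * (c * ‖k'‖) := by field_simp
    _ ≤ _ := by gcongr

/-- Opposite points `y ± t v` with `‖v‖ = 1` are `2 t` apart, so `t ≤ R` for all `t < r`. -/
lemma radius_le_of_ball_subset_ball {X : Type*} [NormedAddCommGroup X] [NormedSpace ℝ X]
    [Nontrivial X] {x y : X} {r R : ℝ} (hr : 0 < r) (h : ball y r ⊆ ball x R) : r ≤ R := by
  obtain ⟨v, hv⟩ := exists_norm_eq X zero_le_one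
  refine le_of_forall_lt_imp_le_of_dense fun t ht => ?_
  rcases le_or_gt t 0 with ht0 | ht0
  · exact ht0.trans (pos_of_mem_ball (h (mem_ball_self hr))).le
  have h1 : y + t • v ∈ ball x R := h (by simp [norm_smul, hv, abs_of_pos ht0, ht])
  have h2 : y - t • v ∈ ball x R := h (by simp [norm_smul, hv, abs_of_pos ht0, ht])
  rw [mem_ball] at h1 h2
  have h3 : dist (y + t • v) (y - t • v) = 2 * t := by
    rw [dist_eq_norm, show y + t • v - (y - t • v) = (2 * t) • v by module, norm_smul, hv,
      Real.norm_eq_abs, abs_of_pos (by linarith), mul_one]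
  linarith [dist_triangle_right (y + t • v) (y - t • v) x]

/-- A bound on the top derivative by the lower ones at one point propagates to all scaled
derivatives on a ball. -/
lemma scaled_derivative_le {X : Type*} [NormedAddCommGroup X] [NormedSpace ℝ X] {f : X → ℝ}
    {y : X} {s M : ℝ} {l : ℕ} (hs : 0 < s) (hs1 : s ≤ 1) (hM : 0 ≤ M)
    (hf : AnalyticOnNhd ℝ f (ball y (2 * s)))
    (htop : ∀ z ∈ ball y (2 * s), ∀ z' ∈ ball y (2 * s), ‖iteratedFDeriv ℝ (l + 1) f z'‖ ≤
      M * ∑ j ∈ Finset.range (l + 1), ‖iteratedFDeriv ℝ j f z‖)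
    {z : X} (hz : z ∈ ball y (2 * s)) {j : ℕ} (hj : j ≤ l + 1) :
    ∀ z' ∈ ball y (2 * s), s ^ j * ‖iteratedFDeriv ℝ j f z'‖ ≤ 5 ^ (l + 1 - j) * (M + 1) *
      ∑ i ∈ Finset.range (l + 1), s ^ i * ‖iteratedFDeriv ℝ i f z‖ := by
  set a := ∑ i ∈ Finset.range (l + 1), s ^ i * ‖iteratedFDeriv ℝ i f z‖ with ha
  have ha0 : 0 ≤ a := Finset.sum_nonneg fun i _ => by positivity
  induction hj using Nat.decreasingInduction with
  | self =>
    intro z' hz'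
    simp only [Nat.sub_self, pow_zero, one_mul]
    have h1 : s ^ (l + 1) * ∑ i ∈ Finset.range (l + 1), ‖iteratedFDeriv ℝ i f z‖ ≤ a := by
      rw [ha, Finset.mul_sum]
      refine Finset.sum_le_sum fun i hi => ?_
      gcongr ?_ * _
      exact pow_le_pow_of_le_one hs.le hs1 (Finset.mem_range.1 hi).le
    calc s ^ (l + 1) * ‖iteratedFDeriv ℝ (l + 1) f z'‖
        ≤ s ^ (l + 1) * (M * ∑ i ∈ Finset.range (l + 1), ‖iteratedFDeriv ℝ i f z‖) := by
          gcongr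
          exact htop z hz z' hz'
      _ = M * (s ^ (l + 1) * ∑ i ∈ Finset.range (l + 1), ‖iteratedFDeriv ℝ i f z‖) := by ring
      _ ≤ M * a := by gcongr
      _ ≤ (M + 1) * a := by nlinarith
  | of_succ j hj ih =>
    intro z' hz'
    set B := 5 ^ (l + 1 - (j + 1)) * (M + 1) * a with hB
    have hB0 : 0 ≤ B := by positivity
    have hd : ∀ x ∈ ball y (2 * s), DifferentiableAt ℝ (iteratedFDeriv ℝ j f) x := fun x hx =>
      ((hf x hx).contDiffAt (n := ⊤)).differentiableAt_iteratedFDeriv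
        (by exact WithTop.coe_lt_top _)
    have h1 := (convex_ball y (2 * s)).norm_image_sub_le_of_norm_fderiv_le (𝕜 := ℝ)
      (C := B / s ^ (j + 1)) hd (fun x hx => by
        rw [norm_fderiv_iteratedFDeriv, le_div_iff₀ (by positivity), mul_comm]
        exact ih x hx) hz hz'
    -- The mean value inequality over the diameter `4 s` adds `4 B` to the value at `z`; hence a
    -- factor 5 per order.
    have h2 : ‖z' - z‖ ≤ 4 * s := by
      rw [← dist_eq_norm]
      rw [mem_ball] at hz hz'
      linarith [dist_triangle_right z' z y]
    have h3 : s ^ j * ‖iteratedFDeriv ℝ j f z‖ ≤ a := Finset.single_le_sum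
      (f := fun i => s ^ i * ‖iteratedFDeriv ℝ i f z‖) (fun i _ => by positivity)
      (Finset.mem_range.2 (by omega))
    have h4 : s ^ j * (B / s ^ (j + 1) * ‖z' - z‖) ≤ 4 * B := by
      calc s ^ j * (B / s ^ (j + 1) * ‖z' - z‖) ≤ s ^ j * (B / s ^ (j + 1) * (4 * s)) := by gcongr
        _ = 4 * B := by rw [pow_succ]; field_simp
    have h5 : ‖iteratedFDeriv ℝ j f z'‖ ≤ ‖iteratedFDeriv ℝ j f z‖ + B / s ^ (j + 1) * ‖z' - z‖ := by
      linarith [norm_le_insert' (iteratedFDeriv ℝ j f z') (iteratedFDeriv ℝ j f z)]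
    have h6 : a ≤ B := by
      rw [hB]
      have : (1 : ℝ) ≤ 5 ^ (l + 1 - (j + 1)) := one_le_pow₀ (by norm_num)
      have : 1 ≤ 5 ^ (l + 1 - (j + 1)) * (M + 1) := by nlinarith
      nlinarith
    calc s ^ j * ‖iteratedFDeriv ℝ j f z'‖
        ≤ s ^ j * (‖iteratedFDeriv ℝ j f z‖ + B / s ^ (j + 1) * ‖z' - z‖) := by gcongr
      _ ≤ 5 * B := by rw [mul_add]; linarith
      _ = 5 ^ (l + 1 - j) * (M + 1) * a := by
        rw [hB, show l + 1 - j = l + 1 - (j + 1) + 1 by omega, pow_succ]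
        ring

/-- Linear combinations of analytic functions are uniformly good near each point, for an absolutely
decaying doubling measure. -/
theorem exists_good_constants {d : ℕ} (hd : 0 < d) {μ : Measure (E d)} {U : Set (E d)}
    (hU : IsOpen U) {D : ℝ} (hD : 0 < D)
    (hfed : ∀ x ∈ μ.support, ∀ r : ℝ, 0 < r → ball x (3 * r) ⊆ U →
      μ (ball x (3 * r)) ≤ ENNReal.ofReal D * μ (ball x r))
    {C α : ℝ} (hC : 0 < C) (hα : 0 < α) (hdec : IsAbsDecayingOnWith μ C α U)
    {V : Type*} [NormedAddCommGroup V] [NormedSpace ℝ V] [FiniteDimensional ℝ V] {g : E d → V}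
    {x₀ : E d} (hx₀ : x₀ ∈ U) (hg : AnalyticAt ℝ g x₀) :
    ∃ R : ℝ, 0 < R ∧ ball x₀ R ⊆ U ∧ AnalyticOnNhd ℝ g (ball x₀ R) ∧
      ∃ C₀ α₀ : ℝ, 0 < C₀ ∧ 0 < α₀ ∧ ∀ (L : V →L[ℝ] ℝ) (y : E d) (s : ℝ), 0 < s →
        ball y (30 * s) ⊆ ball x₀ R → ∀ ρ : ℝ, 0 < ρ → (∃ w ∈ ball y s, ρ ≤ |L (g w)|) →
        ∀ ε : ℝ, 0 < ε → μ (ball y s ∩ {x | |L (g x)| < ε}) ≤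
          ENNReal.ofReal (C₀ * (ε / ρ) ^ α₀) * μ (ball y (3 * s)) := by
  have : Nonempty (Fin d) := ⟨⟨0, hd⟩⟩
  obtain ⟨R₁, hR₁, l, M, hM, hgan, hnd⟩ := exists_uniform_nondegeneracy hg
  obtain ⟨R₂, hR₂, hR₂U⟩ := Metric.isOpen_iff.1 hU x₀ hx₀
  -- The bound `R ≤ 1` forces `s ≤ 1`, needed to rescale derivatives.
  set R := min (min R₁ R₂) 1 with hR
  have hRR₁ : ball x₀ R ⊆ ball x₀ R₁ :=
    ball_subset_ball ((min_le_left _ _).trans (min_le_left _ _))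
  have hRU : ball x₀ R ⊆ U :=
    (ball_subset_ball ((min_le_left _ _).trans (min_le_right _ _))).trans hR₂U
  set K : ℝ := 5 ^ (l + 1) * (M + 1) with hK
  have hK0 : 0 < K := by positivity
  set c : ℝ := ((l + 1) * K)⁻¹ with hc
  have hc0 : 0 < c := by positivity
  set α₀ : ℝ := α / 4 ^ l with hα₀
  have hα₀0 : 0 < α₀ := by positivity
  set C₁ : ℝ := l * (C * (4 + 2 * K) ^ α * D ^ 4) with hC₁
  set C₂ : ℝ := ((l + 1) / c) ^ α with hC₂
  have hC₁0 : 0 ≤ C₁ := by positivity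
  have hC₂0 : 0 < C₂ := by positivity
  refine ⟨R, by positivity, hRU, fun z hz => hgan z (hRR₁ hz), K ^ α₀ * (C₁ + C₂), α₀,
    by positivity, hα₀0, ?_⟩
  rintro L y s hs hyR ρ hρ ⟨w, hw, hρw⟩ ε hε
  have hs1 : s ≤ 1 := by
    have h1 := radius_le_of_ball_subset_ball (by positivity) hyR
    have h2 : R ≤ 1 := min_le_right _ _
    linarith
  have h2R₁ : ball y (2 * s) ⊆ ball x₀ R₁ :=
    (ball_subset_ball (by linarith)).trans (hyR.trans hRR₁)
  have hsub : ball y s ⊆ ball y (2 * s) := ball_subset_ball (by linarith)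
  have hf : AnalyticOnNhd ℝ (L ∘ g) (ball y (2 * s)) := fun z hz =>
    (L.analyticAt _).comp (hgan z (h2R₁ hz))
  have hy : y ∈ ball y s := mem_ball_self hs
  have hscaled : ∀ z ∈ ball y (2 * s), ∀ j ≤ l + 1, ∀ z' ∈ ball y (2 * s),
      s ^ j * ‖iteratedFDeriv ℝ j (L ∘ g) z'‖ ≤
        K * ∑ i ∈ Finset.range (l + 1), s ^ i * ‖iteratedFDeriv ℝ i (L ∘ g) z‖ := by
    intro z hz j hj z' hz'
    refine (scaled_derivative_le hs hs1 hM.le hf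
      (fun z hz z' hz' => hnd L z (h2R₁ hz) z' (h2R₁ hz')) hz hj z' hz').trans ?_
    have : 0 ≤ ∑ i ∈ Finset.range (l + 1), s ^ i * ‖iteratedFDeriv ℝ i (L ∘ g) z‖ :=
      Finset.sum_nonneg fun i _ => by positivity
    rw [hK]
    gcongr
    · norm_num
    · omega
  set A := ∑ i ∈ Finset.range (l + 1), s ^ i * ‖iteratedFDeriv ℝ i (L ∘ g) y‖ with hA
  have hρA : ρ ≤ K * A := by
    have := hscaled y (hsub hy) 0 (by omega) w (hsub hw)
    simp only [pow_zero, one_mul, norm_iteratedFDeriv_zero, Function.comp_apply,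
      Real.norm_eq_abs] at this
    linarith
  have hA0 : 0 < A := by
    by_contra! hcon
    nlinarith
  have hlb : ∀ z ∈ ball y s, c * A ≤
      ∑ j ∈ Finset.range (l + 1), s ^ j * ‖iteratedFDeriv ℝ j (L ∘ g) z‖ := by
    intro z hz
    rw [hc, inv_mul_le_iff₀ (by positivity)]
    calc A ≤ ∑ i ∈ Finset.range (l + 1), K * ∑ j ∈ Finset.range (l + 1),
          s ^ j * ‖iteratedFDeriv ℝ j (L ∘ g) z‖ := Finset.sum_le_sum fun i hi =>
            hscaled z (hsub hz) i (Finset.mem_range.1 hi).le y (hsub hy)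
      _ = _ := by
        rw [Finset.sum_const, Finset.card_range, nsmul_eq_mul]
        push_cast
        ring
  have h4l : (4 : ℝ) ^ l ≠ 0 := by positivity
  -- Chosen so that `τ ^ (4 ^ l) * A = ε`. When `τ` is too large for the sublevel estimate, `C₂`
  -- makes the claimed bound trivial.
  set τ : ℝ := (ε / A) ^ ((4 : ℝ) ^ l)⁻¹ with hτ
  have hεA : 0 < ε / A := by positivity
  have hτ0 : 0 < τ := Real.rpow_pos_of_pos hεA _
  have hτpow : τ ^ (4 ^ l) * A = ε := by
    have : τ ^ (4 ^ l) = ε / A := by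
      rw [hτ, ← Real.rpow_natCast, ← Real.rpow_mul hεA.le]
      push_cast
      rw [inv_mul_cancel₀ h4l, Real.rpow_one]
    rw [this]
    field_simp
  have hτα : τ ^ α = (ε / A) ^ α₀ := by
    rw [hτ, ← Real.rpow_mul hεA.le, hα₀, inv_mul_eq_div]
  have hτle : τ ^ α ≤ K ^ α₀ * (ε / ρ) ^ α₀ := by
    rw [hτα, ← Real.mul_rpow hK0.le (by positivity)]
    refine Real.rpow_le_rpow hεA.le ?_ hα₀0.le
    rw [div_le_iff₀ hA0, ← mul_div_assoc, div_mul_eq_mul_div, le_div_iff₀ hρ]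
    nlinarith
  have hεball : μ (ball y s) ≤ μ (ball y (3 * s)) :=
    measure_mono (ball_subset_ball (by linarith))
  by_cases hτc : (l + 1) * τ < c
  · have hc1 : c ≤ 1 := by
      have h5 : (1 : ℝ) ≤ 5 ^ (l + 1) := one_le_pow₀ (by norm_num)
      have hK1 : 1 ≤ K := by nlinarith
      have hl : (0 : ℝ) ≤ l := by positivity
      exact inv_le_one_of_one_le₀ (by nlinarith)
    have hτ1 : τ ≤ 1 := by
      have hl : (0 : ℝ) ≤ l := by positivity
      nlinarith
    have hmain := measure_sublevel_le_of_derivative_bounds hfed hC.le hα.le hdec hs hA0 hK0.le hτ0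
      hτ1 (((ball_subset_ball (by linarith)).trans hyR).trans hRU) hf l
      (hscaled y (hsub hy)) hlb hτc
    rw [hτpow] at hmain
    refine hmain.trans ?_
    rw [← mul_assoc, ← ENNReal.ofReal_pow hD.le, ← ENNReal.ofReal_mul (by positivity),
      ← ENNReal.ofReal_natCast, ← ENNReal.ofReal_mul (by positivity)]
    gcongr ENNReal.ofReal ?_ * _
    rw [Real.mul_rpow (by positivity) hτ0.le]
    calc l * (C * ((4 + 2 * K) ^ α * τ ^ α) * D ^ 4) = C₁ * τ ^ α := by rw [hC₁]; ring
      _ ≤ (C₁ + C₂) * (K ^ α₀ * (ε / ρ) ^ α₀) := by gcongr; linarith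
      _ = _ := by ring
  · refine (measure_mono inter_subset_left).trans (hεball.trans ?_)
    refine le_mul_of_one_le_left zero_le ?_
    rw [ENNReal.one_le_ofReal]
    have h1 : 1 ≤ (l + 1) / c * τ := by
      rw [div_mul_eq_mul_div, le_div_iff₀ hc0]
      linarith
    calc (1 : ℝ) ≤ ((l + 1) / c * τ) ^ α := Real.one_le_rpow h1 hα.le
      _ = C₂ * τ ^ α := Real.mul_rpow (by positivity) hτ0.le
      _ ≤ (C₁ + C₂) * (K ^ α₀ * (ε / ρ) ^ α₀) := by gcongr; linarith
      _ = _ := by ring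

/-! ### Rational subspaces and covolumes -/

section Lattice

open Matrix

/-- The inclusion `ℤ^k → ℚ^k`. -/
def ratVec (k : ℕ) : (Fin k → ℤ) →ₗ[ℤ] (Fin k → ℚ) where
  toFun v i := v i
  map_add' v w := by ext; simp
  map_smul' c v := by ext; simp

@[simp] lemma ratVec_apply {k : ℕ} (v : Fin k → ℤ) (i : Fin k) : ratVec k v i = v i := rfl

@[simp] lemma intVec_apply {k : ℕ} (v : Fin k → ℤ) (i : Fin k) : intVec k v i = v i := rfl

lemma ratVec_injective (k : ℕ) : Function.Injective (ratVec k) := fun v w h => by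
  ext i
  simpa using congrFun h i

/-- A rational left inverse still inverts over `ℝ`: it carries independence from `ℚ` to `ℝ` and
shows that real coefficients of integer vectors are rational. -/
lemma exists_rational_leftInverse {k r : ℕ} {v : Fin r → Fin k → ℤ}
    (hv : LinearIndependent ℚ fun i => ratVec k (v i)) :
    ∃ P : Matrix (Fin r) (Fin k) ℚ, ∀ i j, ∑ m, P j m * v i m = if i = j then 1 else 0 := by
  obtain ⟨ψ, hψ⟩ := LinearMap.exists_leftInverse_of_injective
    (Fintype.linearCombination ℚ fun i => ratVec k (v i))
    (by rw [LinearMap.ker_eq_bot]; exact hv.fintypeLinearCombination_injective)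
  refine ⟨LinearMap.toMatrix' ψ, fun i j => ?_⟩
  have h1 : ψ (ratVec k (v i)) = Pi.single i 1 := by
    have := LinearMap.congr_fun hψ (Pi.single i 1)
    simpa [Fintype.linearCombination_apply_single] using this
  have h2 : LinearMap.toMatrix' ψ *ᵥ ratVec k (v i) = Pi.single i 1 := by
    rw [← h1]
    exact LinearMap.toMatrix'_mulVec ψ _
  have h3 := congrFun h2 j
  simpa [Matrix.mulVec, dotProduct, Pi.single_apply, eq_comm] using h3

/-- The coordinates of a real combination of rationally independent integer vectors are
rational linear functions of the combination. -/
lemma coeff_eq_of_rational_leftInverse {k r : ℕ} {v : Fin r → Fin k → ℤ}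
    {P : Matrix (Fin r) (Fin k) ℚ}
    (hP : ∀ i j, ∑ m, P j m * v i m = if i = j then 1 else 0) (c : Fin r → ℝ) (j : Fin r) :
    ∑ m, (P j m : ℝ) * (∑ i, c i • intVec k (v i)) m = c j := by
  have hP' : ∀ i, ∑ m, (P j m : ℝ) * (v i m : ℝ) = if i = j then 1 else 0 := fun i => by
    have := congrArg (fun q : ℚ => (q : ℝ)) (hP i j)
    push_cast at this
    rw [this]
    split_ifs <;> simp
  calc ∑ m, (P j m : ℝ) * (∑ i, c i • intVec k (v i)) m
      = ∑ m, ∑ i, c i * ((P j m : ℝ) * (v i m : ℝ)) := by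
        refine Finset.sum_congr rfl fun m _ => ?_
        simp only [WithLp.ofLp_sum, WithLp.ofLp_smul, Finset.sum_apply, Pi.smul_apply,
          smul_eq_mul, intVec_apply, Finset.mul_sum]
        exact Finset.sum_congr rfl fun i _ => by ring
    _ = ∑ i, c i * ∑ m, (P j m : ℝ) * (v i m : ℝ) := by
        rw [Finset.sum_comm]
        simp only [Finset.mul_sum]
    _ = c j := by simp [hP']

lemma linearIndependent_intVec {k r : ℕ} {v : Fin r → Fin k → ℤ}
    (hv : LinearIndependent ℚ fun i => ratVec k (v i)) :
    LinearIndependent ℝ fun i => intVec k (v i) := by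
  obtain ⟨P, hP⟩ := exists_rational_leftInverse hv
  rw [Fintype.linearIndependent_iff]
  intro c hc j
  rw [← coeff_eq_of_rational_leftInverse hP c j, hc]
  simp

lemma isPrimitive_of_saturated {k r : ℕ} {v : Fin r → Fin k → ℤ}
    (hv : LinearIndependent ℚ fun i => ratVec k (v i))
    (hsat : ∀ w, ratVec k w ∈ Submodule.span ℚ (Set.range fun i => ratVec k (v i)) →
      w ∈ Submodule.span ℤ (Set.range v)) : IsPrimitive v := by
  refine ⟨linearIndependent_intVec hv, Set.Subset.antisymm (fun x hx => ⟨?_, ?_⟩) ?_⟩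
  · obtain ⟨c, rfl⟩ := (Submodule.mem_span_range_iff_exists_fun ℤ).1 hx
    exact ⟨∑ i, c i • v i, by simp only [map_sum, map_zsmul]⟩
  · exact Submodule.span_subset_span ℤ ℝ _ hx
  · rintro _ ⟨⟨w, rfl⟩, hx⟩
    obtain ⟨c, hc⟩ := (Submodule.mem_span_range_iff_exists_fun ℝ).1 hx
    obtain ⟨P, hP⟩ := exists_rational_leftInverse hv
    set q : Fin r → ℚ := fun j => ∑ m, P j m * w m with hq
    have hcq : ∀ j, c j = q j := fun j => by
      rw [← coeff_eq_of_rational_leftInverse hP c j, hc, hq]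
      simp
    have hw : ratVec k w = ∑ i, q i • ratVec k (v i) := by
      ext m
      have h1 : (∑ i, c i • intVec k (v i)) m = intVec k w m := by rw [hc]
      simp only [WithLp.ofLp_sum, WithLp.ofLp_smul, Finset.sum_apply, Pi.smul_apply, smul_eq_mul,
        intVec_apply, hcq] at h1
      simp only [Finset.sum_apply, Pi.smul_apply, smul_eq_mul, ratVec_apply]
      exact_mod_cast h1.symm
    obtain ⟨a, ha⟩ := (Submodule.mem_span_range_iff_exists_fun ℤ).1
      (hsat w ((Submodule.mem_span_range_iff_exists_fun ℚ).2 ⟨q, hw.symm⟩))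
    refine (Submodule.mem_span_range_iff_exists_fun ℤ).2 ⟨a, ?_⟩
    rw [← ha]
    simp only [map_sum, map_zsmul]

/-- Every rational subspace has a basis generating its integer points. -/
lemma exists_integral_basis {k : ℕ} (V : Submodule ℚ (Fin k → ℚ)) :
    ∃ v : Fin (Module.finrank ℚ V) → Fin k → ℤ, LinearIndependent ℚ (fun i => ratVec k (v i)) ∧
      Submodule.span ℚ (Set.range fun i => ratVec k (v i)) = V ∧
      ∀ w, ratVec k w ∈ V → w ∈ Submodule.span ℤ (Set.range v) := by
  suffices h : ∃ (r : ℕ) (v : Fin r → Fin k → ℤ), LinearIndependent ℚ (fun i => ratVec k (v i)) ∧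
      Submodule.span ℚ (Set.range fun i => ratVec k (v i)) = V ∧
      ∀ w, ratVec k w ∈ V → w ∈ Submodule.span ℤ (Set.range v) by
    obtain ⟨r, v, hv, hspan, hsat⟩ := h
    obtain rfl : Module.finrank ℚ V = r := by
      rw [← hspan, finrank_span_eq_card hv, Fintype.card_fin]
    exact ⟨v, hv, hspan, hsat⟩
  set L : Submodule ℤ (Fin k → ℤ) := (V.restrictScalars ℤ).comap (ratVec k) with hL
  set b := Module.finBasis ℤ L with hb
  have hsat : ∀ w, ratVec k w ∈ V → w ∈ Submodule.span ℤ (Set.range fun i => (b i : Fin k → ℤ)) := by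
    intro w hw
    refine (Submodule.mem_span_range_iff_exists_fun ℤ).2 ⟨fun i => b.repr ⟨w, hw⟩ i, ?_⟩
    have := congrArg L.subtype (b.sum_repr ⟨w, hw⟩)
    simpa only [map_sum, map_smul, Submodule.subtype_apply] using this
  refine ⟨Module.finrank ℤ L, fun i => b i, ?_, le_antisymm ?_ ?_, hsat⟩
  · rw [← LinearIndependent.iff_fractionRing ℤ ℚ]
    have h1 : LinearIndependent ℤ fun i => (b i : Fin k → ℤ) :=
      b.linearIndependent.map' L.subtype (Submodule.ker_subtype L)
    exact h1.map' (ratVec k) (LinearMap.ker_eq_bot.2 (ratVec_injective k))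
  · rw [Submodule.span_le]
    rintro _ ⟨i, rfl⟩
    exact (b i).2
  · intro x hx
    -- Clearing denominators moves a rational vector into the lattice.
    obtain ⟨m, hm⟩ := IsLocalization.exist_integer_multiples_of_finite (nonZeroDivisors ℤ) x
    choose w hw using hm
    have hwx : ratVec k w = ((m : ℤ) : ℚ) • x := by
      ext i
      have := hw i
      simpa using this
    have hm0 : ((m : ℤ) : ℚ) ≠ 0 := by
      exact_mod_cast nonZeroDivisors.coe_ne_zero m
    obtain ⟨a, ha⟩ := (Submodule.mem_span_range_iff_exists_fun ℤ).1
      (hsat w (by rw [hwx]; exact V.smul_mem _ hx))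
    have h2 : ratVec k w ∈ Submodule.span ℚ (Set.range fun i => ratVec k (b i : Fin k → ℤ)) := by
      rw [← ha, map_sum]
      refine Submodule.sum_mem _ fun i _ => ?_
      rw [map_zsmul]
      exact zsmul_mem (Submodule.subset_span (Set.mem_range_self i)) _
    rw [hwx] at h2
    exact (Submodule.smul_mem_iff _ hm0).1 h2

/-- A basis of the integer points of a rational subspace. -/
def latVec {k : ℕ} (V : Submodule ℚ (Fin k → ℚ)) : Fin (Module.finrank ℚ V) → Fin k → ℤ :=
  (exists_integral_basis V).choose

section
variable {k : ℕ} (V : Submodule ℚ (Fin k → ℚ))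

lemma linearIndependent_latVec : LinearIndependent ℚ fun i => ratVec k (latVec V i) :=
  (exists_integral_basis V).choose_spec.1

lemma span_latVec : Submodule.span ℚ (Set.range fun i => ratVec k (latVec V i)) = V :=
  (exists_integral_basis V).choose_spec.2.1

lemma mem_span_latVec {w : Fin k → ℤ} (hw : ratVec k w ∈ V) :
    w ∈ Submodule.span ℤ (Set.range (latVec V)) :=
  (exists_integral_basis V).choose_spec.2.2 w hw

lemma isPrimitive_latVec : IsPrimitive (latVec V) :=
  isPrimitive_of_saturated (linearIndependent_latVec V) fun w hw =>
    mem_span_latVec V (by rwa [span_latVec] at hw)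

end

/-- A vector killed by `N` on the left would be an integer relation among the `u j`. -/
lemma det_ne_zero_of_linearIndependent {k r : ℕ} {u v : Fin r → Fin k → ℤ}
    (hu : LinearIndependent ℚ fun i => ratVec k (u i)) {N : Matrix (Fin r) (Fin r) ℤ}
    (hN : ∀ j, ∑ i, N j i • v i = u j) : N.det ≠ 0 := by
  intro h0
  obtain ⟨c, hc0, hc⟩ := Matrix.exists_vecMul_eq_zero_iff.2 h0
  have hu' : LinearIndependent ℤ u := by
    rw [← LinearIndependent.iff_fractionRing ℤ ℚ] at hu
    exact LinearIndependent.of_comp (ratVec k) hu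
  refine hc0 (funext fun j => Fintype.linearIndependent_iff.1 hu' c ?_ j)
  calc ∑ j, c j • u j = ∑ j, ∑ i, (c j * N j i) • v i := by
        refine Finset.sum_congr rfl fun j _ => ?_
        rw [← hN j, Finset.smul_sum]
        simp [mul_smul]
    _ = ∑ i, (c ᵥ* N) i • v i := by
        rw [Finset.sum_comm]
        simp [Matrix.vecMul, dotProduct, Finset.sum_smul]
    _ = 0 := by simp [hc]

lemma norm_sq_ιMulti {k r : ℕ} (x : Fin r → E k) :
    ‖exteriorPower.ιMulti ℝ r x‖ ^ 2 = (gram ℝ x).det := by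
  rw [← exteriorPower.inner_ιMulti_self, real_inner_self_eq_norm_sq]

lemma gram_linearCombination {F : Type*} [NormedAddCommGroup F] [InnerProductSpace ℝ F] {r : ℕ}
    (N : Matrix (Fin r) (Fin r) ℝ) (x : Fin r → F) :
    gram ℝ (fun j => ∑ i, N j i • x i) = N * gram ℝ x * Nᵀ := by
  ext i j
  simp only [gram_apply, mul_apply, transpose_apply, sum_inner, inner_sum, real_inner_smul_left,
    real_inner_smul_right, Finset.sum_mul]
  exact Finset.sum_congr rfl fun a _ => Finset.sum_congr rfl fun b _ => by ring

lemma one_le_sq_of_int_ne_zero {m : ℤ} (hm : m ≠ 0) : (1 : ℝ) ≤ (m : ℝ) ^ 2 := by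
  have : 1 ≤ m ^ 2 := by
    have := sq_pos_of_ne_zero hm
    omega
  exact_mod_cast this

/-- The covolume of the integer points of a rational subspace is minimal. -/
lemma norm_wedge_le_of_mem_span {k r : ℕ} (g : Matrix.SpecialLinearGroup (Fin k) ℝ)
    {u v : Fin r → Fin k → ℤ} (hu : LinearIndependent ℚ fun i => ratVec k (u i))
    (huv : ∀ j, u j ∈ Submodule.span ℤ (Set.range v)) : ‖wedge g v‖ ≤ ‖wedge g u‖ := by
  choose N hN using fun j => (Submodule.mem_span_range_iff_exists_fun ℤ).1 (huv j)
  have hdet := det_ne_zero_of_linearIndependent (N := Matrix.of N) hu hN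
  set A : Matrix (Fin r) (Fin r) ℝ := (Matrix.of N).map (Int.castRingHom ℝ) with hA
  have hAdet : A.det = ((Matrix.of N).det : ℝ) := by
    rw [hA, ← RingHom.mapMatrix_apply, ← RingHom.map_det]
    simp
  have hcomb : (fun j => act g (intVec k (u j))) =
      fun j => ∑ i, A j i • act g (intVec k (v i)) := by
    funext j
    rw [← hN j, map_sum, map_sum]
    refine Finset.sum_congr rfl fun i _ => ?_
    rw [map_zsmul, map_zsmul, ← Int.cast_smul_eq_zsmul ℝ]
    simp [hA]
  -- Passing to a sublattice scales the covolume by its index, a nonzero integer determinant up to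
  -- sign.
  have hgram : ‖wedge g u‖ ^ 2 = A.det ^ 2 * ‖wedge g v‖ ^ 2 := by
    rw [wedge, wedge, norm_sq_ιMulti, norm_sq_ιMulti, hcomb, gram_linearCombination, det_mul,
      det_mul, det_transpose]
    ring
  refine (pow_le_pow_iff_left₀ (norm_nonneg _) (norm_nonneg _) two_ne_zero).1 ?_
  rw [hgram, hAdet]
  exact le_mul_of_one_le_left (sq_nonneg _) (one_le_sq_of_int_ne_zero hdet)

lemma norm_wedge_latVec_le {k r : ℕ} (g : Matrix.SpecialLinearGroup (Fin k) ℝ)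
    {V : Submodule ℚ (Fin k → ℚ)} {u : Fin r → Fin k → ℤ}
    (hu : LinearIndependent ℚ fun i => ratVec k (u i)) (huV : ∀ j, ratVec k (u j) ∈ V)
    (hr : r = Module.finrank ℚ V) : ‖wedge g (latVec V)‖ ≤ ‖wedge g u‖ := by
  subst hr
  exact norm_wedge_le_of_mem_span g hu fun j => mem_span_latVec V (huV j)

/-- Fischer's inequality for a vector and a multivector. -/
lemma norm_ιMulti_cons_le {k r : ℕ} (x : E k) (u : Fin r → E k) :
    ‖exteriorPower.ιMulti ℝ (r + 1) (Matrix.vecCons x u)‖ ≤ ‖x‖ * ‖exteriorPower.ιMulti ℝ r u‖ := by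
  -- Only the component of `x` orthogonal to the span of `u` survives in the wedge, and it is no
  -- longer than `x`.
  obtain ⟨p, hp, z, hz, rfl⟩ :=
    (Submodule.span ℝ (Set.range u)).exists_add_mem_mem_orthogonal x
  have hzu : ∀ i, inner ℝ z (u i) = 0 := fun i => by
    rw [real_inner_comm]
    exact (Submodule.mem_orthogonal _ _).1 hz _ (Submodule.subset_span ⟨i, rfl⟩)
  have hdep : exteriorPower.ιMulti ℝ (r + 1) (Matrix.vecCons p u) = 0 := by
    refine AlternatingMap.map_linearDependent _ _ fun h => ?_
    exact (linearIndependent_finCons.1 h).2 hp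
  rw [AlternatingMap.map_vecCons_add, hdep, zero_add]
  have hdet : (gram ℝ (Matrix.vecCons z u)).det = ‖z‖ ^ 2 * (gram ℝ u).det := by
    rw [Matrix.det_succ_row_zero, Fin.sum_univ_succ]
    have h1 : (gram ℝ (Matrix.vecCons z u)).submatrix Fin.succ Fin.succ = gram ℝ u := by
      ext i j
      simp [gram_apply]
    simp [gram_apply, hzu, h1]
  have hnz : ‖z‖ ≤ ‖p + z‖ := by
    have horth : inner ℝ p z = 0 := (Submodule.mem_orthogonal _ _).1 hz p hp
    have := norm_add_sq_eq_norm_sq_add_norm_sq_real horth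
    nlinarith [norm_nonneg z, norm_nonneg (p + z), sq_nonneg ‖p‖]
  refine ((pow_le_pow_iff_left₀ (b := ‖z‖ * ‖exteriorPower.ιMulti ℝ r u‖) (norm_nonneg _)
    (by positivity) two_ne_zero).1 (le_of_eq ?_)).trans (by gcongr)
  rw [mul_pow, norm_sq_ιMulti, norm_sq_ιMulti, hdet]

/-- `w` and the basis of `V` span a finite-index sublattice of the new integer points; minimality of
covolume and Fischer's inequality conclude. -/
lemma norm_wedge_latVec_sup_span_le {k : ℕ} (g : Matrix.SpecialLinearGroup (Fin k) ℝ)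
    {V : Submodule ℚ (Fin k → ℚ)} {w : Fin k → ℤ} (hw : ratVec k w ∉ V) :
    ‖wedge g (latVec (V ⊔ Submodule.span ℚ {ratVec k w}))‖ ≤
      ‖act g (intVec k w)‖ * ‖wedge g (latVec V)‖ := by
  set u : Fin (Module.finrank ℚ V + 1) → Fin k → ℤ := Matrix.vecCons w (latVec V) with hu
  have hur : (fun i => ratVec k (u i)) =
      Matrix.vecCons (ratVec k w) fun i => ratVec k (latVec V i) := by
    funext i
    refine Fin.cases ?_ (fun i => ?_) i <;> simp [hu]
  have hua : (fun i => act g (intVec k (u i))) =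
      Matrix.vecCons (act g (intVec k w)) fun i => act g (intVec k (latVec V i)) := by
    funext i
    refine Fin.cases ?_ (fun i => ?_) i <;> simp [hu]
  have hli : LinearIndependent ℚ fun i => ratVec k (u i) := by
    rw [hur]
    exact linearIndependent_finCons.2 ⟨linearIndependent_latVec V, by rwa [span_latVec]⟩
  have hspan : Submodule.span ℚ (Set.range fun i => ratVec k (u i)) =
      V ⊔ Submodule.span ℚ {ratVec k w} := by
    rw [hur, Matrix.range_cons, Submodule.span_union, span_latVec, sup_comm]
  refine (norm_wedge_latVec_le g hli (fun j => ?_) ?_).trans ?_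
  · rw [← hspan]
    exact Submodule.subset_span ⟨j, rfl⟩
  · rw [← hspan, finrank_span_eq_card hli, Fintype.card_fin]
  · rw [wedge, hua]
    exact norm_ιMulti_cons_le _ _

lemma one_le_norm_wedge_of_full_rank {k r : ℕ} (g : Matrix.SpecialLinearGroup (Fin k) ℝ)
    {v : Fin r → Fin k → ℤ} (hv : LinearIndependent ℚ fun i => ratVec k (v i)) (hr : r = k) :
    1 ≤ ‖wedge g v‖ := by
  subst hr
  have hdet : (Matrix.of v).det ≠ 0 := det_ne_zero_of_linearIndependent
    (v := fun i => Pi.single i 1) hv fun j => by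
      ext m
      simp [Pi.single_apply]
  set A : Matrix (Fin r) (Fin r) ℝ := (Matrix.of v).map (Int.castRingHom ℝ) with hA
  have hAdet : A.det = ((Matrix.of v).det : ℝ) := by
    rw [hA, ← RingHom.mapMatrix_apply, ← RingHom.map_det]
    simp
  have hgram : gram ℝ (fun i => act g (intVec r (v i))) = A * g.1ᵀ * (A * g.1ᵀ)ᵀ := by
    ext i j
    simp only [gram_apply, mul_apply, transpose_apply, PiLp.inner_apply, act,
      Matrix.ofLp_toLpLin, Matrix.toLin'_apply, mulVec, dotProduct]
    refine Finset.sum_congr rfl fun m _ => ?_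
    simp [hA, mul_comm]
  have hsq : ‖wedge g v‖ ^ 2 = ((Matrix.of v).det : ℝ) ^ 2 := by
    rw [wedge, norm_sq_ιMulti, hgram, det_mul, det_transpose, det_mul, det_transpose, g.2, hAdet]
    ring
  refine (pow_le_pow_iff_left₀ zero_le_one (norm_nonneg _) two_ne_zero).1 ?_
  rw [hsq, one_pow]
  exact one_le_sq_of_int_ne_zero hdet

lemma norm_wedge_of_rank_zero {k r : ℕ} (g : Matrix.SpecialLinearGroup (Fin k) ℝ)
    (v : Fin r → Fin k → ℤ) (hr : r = 0) : ‖wedge g v‖ = 1 := by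
  subst hr
  have : ‖wedge g v‖ ^ 2 = 1 := by rw [wedge, norm_sq_ιMulti, det_isEmpty]
  nlinarith [norm_nonneg (wedge g v)]

/-- At a marked point the lattice has no short nonzero vector. -/
lemma le_norm_act_of_marked {k : ℕ} {X : Type*} {h : X → Matrix.SpecialLinearGroup (Fin k) ℝ}
    {ε ρ : ℝ} (hερ : ε ≤ ρ) (hρ1 : ρ ≤ 1) {x : X}
    (hx : Marked (fun (V : Submodule ℚ (Fin k → ℚ)) x => ‖wedge (h x) (latVec V)‖) ε ρ
      {V | V ≠ ⊥ ∧ V ≠ ⊤} x) {w : Fin k → ℤ} (hw : w ≠ 0) : ε ≤ ‖act (h x) (intVec k w)‖ := by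
  obtain ⟨F, hF, hchain, hval, hbig⟩ := hx
  -- the largest member of the flag not containing `w`
  obtain ⟨V, hVF, hwV, hVmax⟩ : ∃ V : Submodule ℚ (Fin k → ℚ), (V ∈ F ∨ V = ⊥) ∧
      ratVec k w ∉ V ∧ ∀ V' ∈ F, ratVec k w ∉ V' → V' ≤ V := by
    set P : Set (Submodule ℚ (Fin k → ℚ)) := {V | (V ∈ F ∨ V = ⊥) ∧ ratVec k w ∉ V} with hP
    have hPne : P.Nonempty := ⟨⊥, Or.inr rfl, fun h0 => hw (ratVec_injective k (by simpa using h0))⟩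
    obtain ⟨V, hV, hmax⟩ := WellFounded.has_min (r := fun a b : Submodule ℚ (Fin k → ℚ) => a > b)
      wellFounded_gt P hPne
    refine ⟨V, hV.1, hV.2, fun V' hV' hwV' => ?_⟩
    have hcomp : V ≤ V' ∨ V' ≤ V := by
      rcases hV.1 with h1 | rfl
      · exact hchain V h1 V' hV'
      · exact Or.inl bot_le
    rcases hcomp with hle | hle
    · rcases hle.eq_or_lt with rfl | hlt
      · exact le_rfl
      · exact (hmax V' ⟨Or.inl hV', hwV'⟩ hlt).elim
    · exact hle
  set W := V ⊔ Submodule.span ℚ {ratVec k w} with hW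
  have hwW : ratVec k w ∈ W :=
    (le_sup_right : _ ≤ W) (Submodule.mem_span_singleton_self _)
  have hWbot : W ≠ ⊥ := fun h0 => by
    rw [h0] at hwW
    exact hw (ratVec_injective k (by simpa using hwW))
  -- Members of the flag containing `w` contain `V` too, hence `W`; the others lie in `V`.
  have hWcomp : ∀ V' ∈ F, W ≤ V' ∨ V' ≤ W := by
    intro V' hV'
    by_cases hwV' : ratVec k w ∈ V'
    · left
      refine sup_le ?_ (by rwa [Submodule.span_singleton_le_iff_mem])
      rcases hVF with h1 | rfl
      · rcases hchain V h1 V' hV' with h2 | h2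
        · exact h2
        · exact (hwV (h2 hwV')).elim
      · exact bot_le
    · exact Or.inr ((hVmax V' hV' hwV').trans le_sup_left)
  have hεW : ε ≤ ‖wedge (h x) (latVec W)‖ := by
    by_cases hWtop : W = ⊤
    · refine (hερ.trans hρ1).trans
        (one_le_norm_wedge_of_full_rank _ (linearIndependent_latVec W) ?_)
      rw [hWtop, finrank_top, Module.finrank_fin_fun]
    · by_cases hWF : W ∈ F
      · exact (hval W hWF).1
      · exact hερ.trans (hbig W ⟨hWbot, hWtop⟩ hWF hWcomp)
  have hV1 : ‖wedge (h x) (latVec V)‖ ≤ 1 := by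
    rcases hVF with h1 | h1
    · exact (hval V h1).2.trans hρ1
    · exact (norm_wedge_of_rank_zero _ _ (by rw [h1, finrank_bot])).le
  calc ε ≤ ‖wedge (h x) (latVec W)‖ := hεW
    _ ≤ ‖act (h x) (intVec k w)‖ * ‖wedge (h x) (latVec V)‖ :=
      norm_wedge_latVec_sup_span_le _ hwV
    _ ≤ ‖act (h x) (intVec k w)‖ := mul_le_of_le_one_right (norm_nonneg _) hV1

end Lattice

/-! ### Wedge coordinates and minors -/

/-- All minors of a matrix. -/
def minors {k : ℕ} (A : Matrix (Fin k) (Fin k) ℝ) :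
    (Σ r : Fin (k + 1), (Fin r → Fin k) × (Fin r → Fin k)) → ℝ :=
  fun i => (A.submatrix i.2.1 i.2.2).det

lemma analyticAt_minors {k : ℕ} {X : Type*} [NormedAddCommGroup X] [NormedSpace ℝ X]
    {A : X → Matrix (Fin k) (Fin k) ℝ} {x : X} (hA : ∀ i j, AnalyticAt ℝ (fun x => A x i j) x) :
    AnalyticAt ℝ (fun x => minors (A x)) x := by
  refine AnalyticAt.pi fun i => ?_
  simp only [minors, Matrix.det_apply', Matrix.submatrix_apply]
  exact Finset.analyticAt_fun_sum _ fun σ _ =>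
    analyticAt_const.mul (Finset.analyticAt_fun_prod _ fun j _ => hA _ _)

/-- The orthonormal basis `e_{i_1} ∧ ⋯ ∧ e_{i_r}` of the exterior power. -/
def wedgeBasis (k r : ℕ) :
    OrthonormalBasis (Set.powersetCard (Fin k) r) ℝ (⋀[ℝ]^r (E k)) :=
  (EuclideanSpace.basisFun (Fin k) ℝ).exteriorPower r

lemma wedgeBasis_apply {k r : ℕ} (s : Set.powersetCard (Fin k) r) :
    wedgeBasis k r s = exteriorPower.ιMulti ℝ r fun i =>
      EuclideanSpace.basisFun (Fin k) ℝ (Set.powersetCard.ofFinEmbEquiv.symm s i) := by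
  rw [wedgeBasis, ← OrthonormalBasis.coe_toBasis, OrthonormalBasis.toBasis_exteriorPower,
    exteriorPower.basis_apply, exteriorPower.ιMulti_family, OrthonormalBasis.coe_toBasis]
  rfl

lemma wedgeBasis_repr_ιMulti {k r : ℕ} (x : Fin r → E k) (s : Set.powersetCard (Fin k) r) :
    (wedgeBasis k r).repr (exteriorPower.ιMulti ℝ r x) s =
      (Matrix.of fun i j => x i (Set.powersetCard.ofFinEmbEquiv.symm s j)).det := by
  rw [wedgeBasis, ← OrthonormalBasis.coe_toBasis_repr_apply,
    OrthonormalBasis.toBasis_exteriorPower, exteriorPower.basis_repr_apply,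
    exteriorPower.ιMultiDual_apply_ιMulti]
  congr 1

/-- For diagonal `g`, the coordinates of `(g h) v_1 ∧ ⋯ ∧ (g h) v_r` are linear in the minors
of `h`. -/
lemma exists_wedge_coord_eq {k r : ℕ} (hr : r ≤ k) {g : Matrix.SpecialLinearGroup (Fin k) ℝ}
    (hg : g.1.IsDiag) (v : Fin r → Fin k → ℤ) (s : Set.powersetCard (Fin k) r) :
    ∃ L : ((Σ r : Fin (k + 1), (Fin r → Fin k) × (Fin r → Fin k)) → ℝ) →L[ℝ] ℝ,
      ∀ h : Matrix.SpecialLinearGroup (Fin k) ℝ,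
        (wedgeBasis k r).repr (wedge (g * h) v) s = L (minors h.1) := by
  set ω : ⋀[ℝ]^r (E k) := exteriorPower.ιMulti ℝ r fun i => intVec k (v i) with hω
  set e := fun t : Set.powersetCard (Fin k) r => (Set.powersetCard.ofFinEmbEquiv.symm t : Fin r → Fin k)
    with he
  -- Diagonal `g` only rescales the coordinate `s`, by the product of its entries over `s`; the
  -- remaining factor is the Cauchy–Binet expansion of `h` applied to `ω`.
  refine ⟨∑ t, ((wedgeBasis k r).repr ω t * ∏ j, g.1 (e s j) (e s j)) •
    ContinuousLinearMap.proj (⟨⟨r, by omega⟩, (e s, e t)⟩ :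
      Σ r : Fin (k + 1), (Fin r → Fin k) × (Fin r → Fin k)), fun h => ?_⟩
  have hmap : wedge (g * h) v =
      ∑ t, (wedgeBasis k r).repr ω t • exteriorPower.map r (act (g * h)) (wedgeBasis k r t) := by
    rw [show wedge (g * h) v = exteriorPower.map r (act (g * h)) ω by
      rw [hω, exteriorPower.map_apply_ιMulti]; rfl]
    conv_lhs => rw [← (wedgeBasis k r).sum_repr ω]
    simp
  have hentry : ∀ t i j, act (g * h) (EuclideanSpace.basisFun (Fin k) ℝ (e t i)) (e s j) =
      g.1 (e s j) (e s j) * h.1 (e s j) (e t i) := by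
    intro t i j
    have h1 : act (g * h) (EuclideanSpace.basisFun (Fin k) ℝ (e t i)) (e s j) =
        (g.1 * h.1) (e s j) (e t i) := by
      simp [act, Matrix.toLpLin_apply, EuclideanSpace.basisFun_apply]
      rfl
    rw [h1, Matrix.mul_apply]
    refine Finset.sum_eq_single _ (fun m _ hm => ?_) (by simp)
    rw [hg hm.symm, zero_mul]
  have hcoord : ∀ t, (wedgeBasis k r).repr
      (exteriorPower.map r (act (g * h)) (wedgeBasis k r t)) s =
      (∏ j, g.1 (e s j) (e s j)) * (h.1.submatrix (e s) (e t)).det := by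
    intro t
    rw [wedgeBasis_apply, exteriorPower.map_apply_ιMulti, wedgeBasis_repr_ιMulti,
      ← Matrix.det_transpose (h.1.submatrix (e s) (e t)), ← Matrix.det_mul_row]
    congr 1
    ext i j
    exact hentry t i j
  rw [hmap, map_sum]
  simp only [map_smul, WithLp.ofLp_sum, WithLp.ofLp_smul, Finset.sum_apply, Pi.smul_apply,
    hcoord, smul_eq_mul, _root_.sum_apply, _root_.smul_apply,
    ContinuousLinearMap.proj_apply, minors]
  exact Finset.sum_congr rfl fun t _ => by ring

lemma norm_eq_sqrt_wedgeBasis {k r : ℕ} (ω : ⋀[ℝ]^r (E k)) :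
    ‖ω‖ = Real.sqrt (∑ s, (wedgeBasis k r).repr ω s ^ 2) := by
  rw [← LinearIsometryEquiv.norm_map (wedgeBasis k r).repr ω, EuclideanSpace.norm_eq]
  simp

lemma abs_wedgeBasis_repr_le {k r : ℕ} (ω : ⋀[ℝ]^r (E k)) (s : Set.powersetCard (Fin k) r) :
    |(wedgeBasis k r).repr ω s| ≤ ‖ω‖ := by
  rw [← LinearIsometryEquiv.norm_map (wedgeBasis k r).repr ω]
  exact PiLp.norm_apply_le ((wedgeBasis k r).repr ω) s

/-- The norm is at most the sum of at most `2 ^ k` absolute coordinates; the extra 1 makes the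
comparison strict. -/
lemma exists_large_wedgeBasis_repr {k r : ℕ} {ω : ⋀[ℝ]^r (E k)} {ρ : ℝ} (hρ : 0 < ρ)
    (hω : ρ ≤ ‖ω‖) :
    ∃ s, ρ / (2 ^ k + 1) ≤ |(wedgeBasis k r).repr ω s| := by
  have h1 : ‖ω‖ ≤ ∑ s, |(wedgeBasis k r).repr ω s| := by
    conv_lhs => rw [← (wedgeBasis k r).sum_repr ω]
    refine (norm_sum_le _ _).trans (Finset.sum_le_sum fun s _ => ?_)
    rw [norm_smul, (wedgeBasis k r).norm_eq_one, mul_one, Real.norm_eq_abs]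
  have hcard : (Fintype.card (Set.powersetCard (Fin k) r) : ℝ) ≤ 2 ^ k := by
    rw [Fintype.card_eq_nat_card, Set.powersetCard.card, Nat.card_eq_fintype_card, Fintype.card_fin]
    exact_mod_cast Nat.choose_le_two_pow k r
  have h2 : ∑ _s : Set.powersetCard (Fin k) r, ρ / (2 ^ k + 1) < ∑ s, |(wedgeBasis k r).repr ω s| := by
    refine lt_of_lt_of_le ?_ (hω.trans h1)
    rw [Finset.sum_const, Finset.card_univ, nsmul_eq_mul, ← mul_div_assoc,
      div_lt_iff₀ (by positivity)]
    nlinarith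
  obtain ⟨s, -, hs⟩ := Finset.exists_lt_of_sum_lt h2
  exact ⟨s, hs.le⟩

lemma mem_K_of_forall_le {k : ℕ} {g : Matrix.SpecialLinearGroup (Fin k) ℝ} {ε : ℝ}
    (h : ∀ w : Fin k → ℤ, w ≠ 0 → ε ≤ ‖act g (intVec k w)‖) : lattice g ∈ K k ε := by
  refine ⟨⟨g, rfl⟩, ?_⟩
  rintro _ ⟨_, ⟨w, rfl⟩, rfl⟩ hw
  refine h w fun h0 => hw ?_
  simp [h0]

/-- A coordinate large at one point of the ball is a good function, and it is small wherever the
norm is. -/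
lemma measure_wedge_sublevel_le {k d : ℕ} {μ : Measure (E d)} {W : Set (E d)} {C₀ α₀ : ℝ}
    {h₀ : E d → Matrix.SpecialLinearGroup (Fin k) ℝ}
    (hgood : ∀ (L : ((Σ r : Fin (k + 1), (Fin r → Fin k) × (Fin r → Fin k)) → ℝ) →L[ℝ] ℝ)
      (y : E d) (s : ℝ), 0 < s → ball y (30 * s) ⊆ W → ∀ ρ : ℝ, 0 < ρ →
        (∃ w ∈ ball y s, ρ ≤ |L (minors (h₀ w).1)|) → ∀ ε : ℝ, 0 < ε →
        μ (ball y s ∩ {x | |L (minors (h₀ x).1)| < ε}) ≤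
          ENNReal.ofReal (C₀ * (ε / ρ) ^ α₀) * μ (ball y (3 * s)))
    {g : Matrix.SpecialLinearGroup (Fin k) ℝ} (hg : g.1.IsDiag) {r : ℕ} (hr : r ≤ k)
    (v : Fin r → Fin k → ℤ) {y : E d} {s : ℝ} (hs : 0 < s) (hyW : ball y (30 * s) ⊆ W) {ρ ε : ℝ}
    (hρ : 0 < ρ) (hε : 0 < ε) (hlarge : ∃ w ∈ ball y s, ρ ≤ ‖wedge (g * h₀ w) v‖) :
    μ (ball y s ∩ {x | ‖wedge (g * h₀ x) v‖ < ε}) ≤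
      ENNReal.ofReal (C₀ * (ε / (ρ / (2 ^ k + 1))) ^ α₀) * μ (ball y (3 * s)) := by
  obtain ⟨w, hw, hρw⟩ := hlarge
  obtain ⟨i, hi⟩ := exists_large_wedgeBasis_repr hρ hρw
  obtain ⟨L, hL⟩ := exists_wedge_coord_eq hr hg v i
  rw [hL] at hi
  refine (measure_mono ?_).trans (hgood L y s hs hyW _ (by positivity) ⟨w, hw, hi⟩ ε hε)
  rintro x ⟨hx, hxε⟩
  refine ⟨hx, ?_⟩
  rw [mem_ofPred_eq, ← hL]
  exact (abs_wedgeBasis_repr_le _ _).trans_lt hxε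

lemma continuousOn_norm_wedge {k d : ℕ} {W : Set (E d)}
    {h₀ : E d → Matrix.SpecialLinearGroup (Fin k) ℝ}
    (hh₀ : ContinuousOn (fun x => minors (h₀ x).1) W)
    {g : Matrix.SpecialLinearGroup (Fin k) ℝ} (hg : g.1.IsDiag) {r : ℕ} (hr : r ≤ k)
    (v : Fin r → Fin k → ℤ) : ContinuousOn (fun x => ‖wedge (g * h₀ x) v‖) W := by
  choose L hL using exists_wedge_coord_eq hr hg v
  simp only [norm_eq_sqrt_wedgeBasis, hL]
  exact Real.continuous_sqrt.comp_continuousOn <| continuousOn_finsetSum _ fun s _ =>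
    ((L s).continuous.comp_continuousOn hh₀).pow 2

lemma finrank_rational_le {k : ℕ} (V : Submodule ℚ (Fin k → ℚ)) : Module.finrank ℚ V ≤ k := by
  simpa using V.finrank_le

end QND
end

/-! ### Assembly of the theorem -/

open Metric Set in
theorem mainTheorem8 (n d : ℕ) (hn : 0 < n) (hd : 0 < d) (D : ℝ) (hD : 0 < D)
    (U : Set (EuclideanSpace ℝ (Fin d))) (hU : IsOpen U)
    (h₀ : EuclideanSpace ℝ (Fin d) → Matrix.SpecialLinearGroup (Fin (n + 1)) ℝ)
    (hh₀ : ∀ i j : Fin (n + 1), AnalyticOnNhd ℝ (fun x => (h₀ x).1 i j) U)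
    (μ : MeasureTheory.Measure (EuclideanSpace ℝ (Fin d)))
    [MeasureTheory.IsLocallyFiniteMeasure μ]
    (hdecay : QND.IsAbsDecayingOn μ U) (hfed : QND.IsFedererOn μ D U) :
    ∀ x₀ ∈ μ.support ∩ U,
      ∃ R : ℝ, 0 < R ∧ Metric.ball x₀ R ⊆ U ∧
      ∃ C₀ α₀ : ℝ, 0 < C₀ ∧ 0 < α₀ ∧
        ∀ (y : EuclideanSpace ℝ (Fin d)) (s : ℝ), 0 < s → Metric.ball y s ⊆ Metric.ball x₀ R →
        ∀ g : Matrix.SpecialLinearGroup (Fin (n + 1)) ℝ, g.1.IsDiag →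
        ∀ ρ : ℝ, 0 < ρ → ρ ≤ 1 →
          (∀ ε : ℝ, 0 < ε →
            μ {x | x ∈ Metric.ball y s ∧ QND.lattice (g * h₀ x) ∉ QND.K (n + 1) ε} ≤
              ENNReal.ofReal (C₀ * (ε / ρ) ^ α₀) * μ (Metric.ball y (3 * s))) ∨
          (∃ (r : ℕ) (v : Fin r → Fin (n + 1) → ℤ), 1 ≤ r ∧ r ≤ n ∧ QND.IsPrimitive v ∧
            (⨆ x ∈ Metric.ball y s, ‖QND.wedge (g * h₀ x) v‖ₑ) < ENNReal.ofReal ρ) := by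
  rintro x₀ ⟨-, hx₀⟩
  obtain ⟨C, α, hC, hα, hdec⟩ := hdecay
  have hfed' : ∀ x ∈ μ.support, ∀ r : ℝ, 0 < r → ball x (3 * r) ⊆ U →
      μ (ball x (3 * r)) ≤ ENNReal.ofReal D * μ (ball x r) := fun x hx r hr hxr =>
    (hfed x ⟨hx, hxr (mem_ball_self (by positivity))⟩ r hr hxr).le
  obtain ⟨R, hR, hRU, hGan, C₀, α₀, hC₀, hα₀, hgood⟩ := QND.exists_good_constants hd hU hD hfed'
    hC hα hdec hx₀ (g := fun x => QND.minors (h₀ x).1)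
    (QND.analyticAt_minors fun i j => hh₀ i j x₀ hx₀)
  have hGcont : ContinuousOn (fun x => QND.minors (h₀ x).1) (ball x₀ R) := hGan.continuousOn
  set N : ℝ := 2 ^ (n + 1) + 1 with hN
  have hN0 : 0 < N := by positivity
  set S : ℝ := ∑ i ∈ Finset.range n, (D ^ 4) ^ (i + 1) with hS
  have hS0 : 0 ≤ S := Finset.sum_nonneg fun i _ => by positivity
  have hM : (0 : ℝ) < 1 + 30 * 7 ^ n := by positivity
  -- The radius leaves room for the ball of radius `30 * 7 ^ n * s` about `y`. In the constant, `2 ^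
  -- α₀` covers the trivial range `ε > ρ / 2`.
  refine ⟨R / (1 + 30 * 7 ^ n), by positivity, (ball_subset_ball (div_le_self hR.le (by
    have : (0 : ℝ) < 30 * 7 ^ n := by positivity
    linarith))).trans hRU, S * C₀ * (2 * N) ^ α₀ + 2 ^ α₀, α₀, by positivity, hα₀, ?_⟩
  intro y s hs hys g hg ρ hρ hρ1
  by_cases hsmall : ∃ (r : ℕ) (v : Fin r → Fin (n + 1) → ℤ), 1 ≤ r ∧ r ≤ n ∧ QND.IsPrimitive v ∧
      (⨆ x ∈ Metric.ball y s, ‖QND.wedge (g * h₀ x) v‖ₑ) < ENNReal.ofReal ρ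
  · exact Or.inr hsmall
  refine Or.inl fun ε hε => ?_
  have : Nonempty (Fin d) := ⟨⟨0, hd⟩⟩
  have hsR := QND.radius_le_of_ball_subset_ball hs hys
  have hyR : dist y x₀ < R / (1 + 30 * 7 ^ n) := hys (mem_ball_self hs)
  have hyW : ball y (30 * 7 ^ n * s) ⊆ ball x₀ R := by
    refine ball_subset_ball' ?_
    have h1 : 30 * 7 ^ n * s ≤ 30 * 7 ^ n * (R / (1 + 30 * 7 ^ n)) := by gcongr
    have h2 : (1 + 30 * 7 ^ n) * (R / (1 + 30 * 7 ^ n)) = R := by field_simp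
    linarith
  rcases le_or_gt ε (ρ / 2) with hερ | hερ
  · set ψ : Submodule ℚ (Fin (n + 1) → ℚ) → QND.E d → ℝ :=
      fun V x => ‖QND.wedge (g * h₀ x) (QND.latVec V)‖ with hψ
    have hrank : ∀ V : Submodule ℚ (Fin (n + 1) → ℚ), V ≠ ⊥ → V ≠ ⊤ →
        1 ≤ Module.finrank ℚ V ∧ Module.finrank ℚ V ≤ n := by
      intro V hbot htop
      have h1 := Submodule.finrank_lt htop
      rw [Module.finrank_fin_fun] at h1
      exact ⟨Submodule.one_le_finrank_iff.2 hbot, by omega⟩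
    have hlarge : ∀ V ∈ {V : Submodule ℚ (Fin (n + 1) → ℚ) | V ≠ ⊥ ∧ V ≠ ⊤},
        ∃ w ∈ ball y s, ρ / 2 ≤ ψ V w := by
      rintro V ⟨hbot, htop⟩
      by_contra! hcon
      refine hsmall ⟨_, QND.latVec V, (hrank V hbot htop).1, (hrank V hbot htop).2,
        QND.isPrimitive_latVec V, ?_⟩
      refine lt_of_le_of_lt (b := ENNReal.ofReal (ρ / 2)) (iSup₂_le fun x hx => ?_)
        ((ENNReal.ofReal_lt_ofReal_iff hρ).2 (by linarith))
      rw [← ofReal_norm]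
      exact ENNReal.ofReal_le_ofReal (hcon x hx).le
    have hmain := QND.measure_not_marked_le hfed' isOpen_ball hRU
      (fun V : Submodule ℚ (Fin (n + 1) → ℚ) => Module.finrank ℚ V)
      (fun V V' hle heq => Submodule.eq_of_le_of_finrank_eq hle heq) (ψ := ψ)
      (fun V => QND.continuousOn_norm_wedge hGcont hg (QND.finrank_rational_le V) _)
      (ε := ε) (ρ := ρ / 2)
      (fun V z t ht hzW hV => QND.measure_wedge_sublevel_le hgood hg (QND.finrank_rational_le V)
        _ ht hzW (by positivity) hε hV) n {V | V ≠ ⊥ ∧ V ≠ ⊤} (Finset.Icc 1 n) (by simp)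
      (fun V hV => Finset.mem_Icc.2 (hrank V hV.1 hV.2)) y s hyW hlarge
    refine (measure_mono ?_).trans (hmain.trans ?_)
    · rintro x ⟨hx, hxK⟩
      exact ⟨hx, fun hmarked => hxK (QND.mem_K_of_forall_le fun w hw =>
        QND.le_norm_act_of_marked (h := fun x => g * h₀ x) hερ (by linarith) hmarked hw)⟩
    · have hsum : ∑ i ∈ Finset.range n, (ENNReal.ofReal D ^ 4) ^ (i + 1) = ENNReal.ofReal S := by
        rw [hS, ENNReal.ofReal_sum_of_nonneg fun i _ => by positivity]
        refine Finset.sum_congr rfl fun i _ => ?_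
        rw [← ENNReal.ofReal_pow hD.le, ← ENNReal.ofReal_pow (by positivity)]
      rw [hsum, ← ENNReal.ofReal_mul hS0]
      gcongr ENNReal.ofReal ?_ * _
      rw [show ε / (ρ / 2 / (2 ^ (n + 1) + 1)) = 2 * N * (ε / ρ) by rw [hN]; field_simp,
        Real.mul_rpow (by positivity) (by positivity), add_mul]
      have : 0 ≤ (2 : ℝ) ^ α₀ * (ε / ρ) ^ α₀ := by positivity
      linarith
  · have hsub : {x | x ∈ ball y s ∧ QND.lattice (g * h₀ x) ∉ QND.K (n + 1) ε} ⊆ ball y (3 * s) :=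
      fun x hx => ball_subset_ball (by linarith) hx.1
    refine (measure_mono hsub).trans (le_mul_of_one_le_left zero_le ?_)
    rw [ENNReal.one_le_ofReal, add_mul, ← Real.mul_rpow zero_le_two (by positivity)]
    have h1 : 1 ≤ 2 * (ε / ρ) := by
      rw [← mul_div_assoc, le_div_iff₀ hρ]
      linarith
    have h2 : 1 ≤ (2 * (ε / ρ)) ^ α₀ := Real.one_le_rpow h1 hα₀.le
    have h3 : 0 ≤ S * C₀ * (2 * N) ^ α₀ * (ε / ρ) ^ α₀ := by positivity
    linarith
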